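/- **Setting.** Let $N\ge 2$ be an integer, let $\alpha,\lambda,l>0$ and $k_1,\dots,k_N\in(0,l)$. Agents are indexed by $i,j\in\{1,\dots,N\}$, and every index of an agent or of a gain is read modulo $N$ in $\{1,\dots,N\}$ (in particular $0$ is read as $N$). Let $f^{(i)}\in C([0,1]\times[0,\infty))$ and $q^{(i)},d_0^{(i)},d_1^{(i)},r\in C^1([0,\infty))$. Let $u^{(i)},u^{\mathrm{ref}},v^{(i)},\hat q^{(i)}$ belong to $C([0,\infty);H^2(0,1))\cap C^1((0,\infty);L^2(0,1))$, have initial data $u_0^{(i)},u_0^{\mathrm{ref}},v_0^{(i)},\hat q_0^{(i)}$ at $t=0$, and satisfy, on $(0,1)\times(0,\infty)$ and for all $t>0$, the closed-loop system $$u^{(i)}_t=\alpha u^{(i)}_{xx}-\lambda u^{(i)}+f^{(i)},\quad u^{(i)}(0,t)=q^{(i)}(t)+U_0^{(i)}(t),\quad u^{(i)}_x(1,t)=-l\,u^{(i)}(1,t)+U_1^{(i)}(t),$$ $$u^{\mathrm{ref}}_t=\alpha u^{\mathrm{ref}}_{xx}-\lambda u^{\mathrm{ref}},\quad u^{\mathrm{ref}}(0,t)=r(t),\quad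 u^{\mathrm{ref}}_x(1,t)=-l\,u^{\mathrm{ref}}(1,t),$$ $$v^{(i)}_t=\alpha v^{(i)}_{xx}-\lambda v^{(i)},\quad v^{(i)}(0,t)=U_0^{(i)}(t),\quad v^{(i)}_x(1,t)=-l\,v^{(i)}(1,t)+U_1^{(i)}(t),$$ $$\hat q^{(i)}_t=\alpha \hat q^{(i)}_{xx}-\lambda \hat q^{(i)},\quad \hat q^{(i)}_x(0,t)=u^{(i)}_x(0,t)-v^{(i)}_x(0,t),\quad \hat q^{(i)}_x(1,t)=-l\,\hat q^{(i)}(1,t),$$ with the control laws $$U_0^{(i)}(t)=r(t)-\hat q^{(i)}(0,t)+d_0^{(i)}(t),\qquad U_1^{(i)}(t)=k_i\big(u^{(i-1)}(1,t)-u^{\mathrm{ref}}(1,t)\big)+d_1^{(i)}(t).$$ **Notation.** $\|\cdot\|_{C(S)}$ is the maximum norm on $S$; $\overline Q_t=[0,1]\times[0,t]$; $h^{(i,j)}=h^{(i)}-h^{(j)}$. The tracking errors are $\tilde u^{(i)}=u^{(i)}-u^{\mathrm{ref}}$, with $\tilde u^{(i)}_0=u^{(i)}_0-u^{\mathrm{ref}}_0$;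 the synchronization errors are $\tilde u^{(i,j)}=u^{(i)}-u^{(j)}$; and $\tilde q_0^{(i)}=u^{(i)}_0-v^{(i)}_0-\hat q^{(i)}_0$. For $\sigma\in(0,\lambda)$ put $$\mathcal D(t)=\tfrac{2}{\lambda-\sigma}\max_i\|f^{(i)}\|_{C(\overline Q_t)}+\max_i\|d_0^{(i)}\|_{C([0,t])}+\tfrac1l\max_i\|d_1^{(i)}\|_{C([0,t])},$$ $$\widetilde{\mathcal D}(t)=\tfrac{2}{\lambda-\sigma}\max_{i,j}\|f^{(i,j)}\|_{C(\overline Q_t)}+\max_{i,j}\|d_0^{(i,j)}\|_{C([0,t])}+\tfrac1l\max_{i,j}\|d_1^{(i,j)}\|_{C([0,t])},$$ $$\mathcal I=\max_i\|\tilde u_0^{(i)}\|_{C([0,1])}+\max_i\|\tilde q_0^{(i)}\|_{C([0,1])},\qquad \widetilde{\mathcal I}=\max_{i,j}\|\tilde u_0^{(i,j)}\|_{C([0,1])}+\max_{i,j}\|\tilde q_0^{(i,j)}\|_{C([0,1])},$$ $$\mathcal N=\frac{\prod_{i=1}^N k_i}{l^N},\qquad \mathcal M_i=1+\sum_{m=1}^{i}\frac{\prod_{r=0}^{m-1}k_{i-r}}{l^m}+\sum_{m=i+1}^{N-1}\frac{\big(\prod_{r=0}^{i-1}k_{i-r}\big)\big(\prod_{s=0}^{m-i-1}k_{N-s}\big)}{l^m},$$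 $$\mathcal C_i=\frac{\mathcal M_i}{1-\mathcal N},\qquad \widetilde{\mathcal C}_i=1+\frac{k_i}{l}\,\mathcal C_{i-1},\qquad \mathcal K_{j,m}=\Big(\prod_{r=0}^{j-1}k_{j-r}\Big)\Big(\prod_{s=1}^{m-j}k_{N+1-s}\Big),$$ $$\mathcal H_{i,j}=\frac{|k_i-k_j|}{l}+\sum_{m=1}^{j}\frac{\big(\prod_{r=0}^{m-1}k_{j-r}\big)|k_{i-m}-k_{j-m}|}{l^{m+1}}+\sum_{m=j+1}^{N-1}\frac{\mathcal K_{j,m}\,|k_{i-m+N}-k_{j-m+N}|}{l^{m+1}},$$ $$\widetilde{\mathcal H}_{i,j}=\frac{k_j\,\mathcal H_{i-1,j-1}}{l(1-\mathcal N)}+\frac{|k_i-k_j|}{l}.$$ **Theorem.** For all $\sigma\in(0,\lambda)$ and all $i,j\in\{1,\dots,N\}$: 1. for all $t>0$, $$\|\tilde u^{(i,j)}(\cdot,t)\|_{C([0,1])}\le\widetilde{\mathcal C}_j\,\widetilde{\mathcal D}(t)+\widetilde{\mathcal C}_j\,e^{-\sigma t}\,\widetilde{\mathcal I}+\widetilde{\mathcal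 H}_{i,j}\Big(\max_{1\le m\le N}\widetilde{\mathcal C}_m\Big)\big\{\mathcal D(t)+e^{-\sigma t}\,\mathcal I\big\};$$ 2. if all $f^{(m)}$, $d_0^{(m)}$, $d_1^{(m)}$ vanish identically, then for all $t>0$ $$\|\tilde u^{(i,j)}(\cdot,t)\|_{C([0,1])}\le\Big(\widetilde{\mathcal C}_j\,\widetilde{\mathcal I}+\widetilde{\mathcal H}_{i,j}\max_{1\le m\le N}\widetilde{\mathcal C}_m\;\mathcal I\Big)e^{-\sigma t};$$ 3. if all $f^{(m)}$, $d_0^{(m)}$, $d_1^{(m)}$ are bounded, then $\|\tilde u^{(i,j)}(\cdot,t)\|_{C([0,1])}$ is bounded over $t>0$. -/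

import Mathlib

open Set Filter Topology MeasureTheory
open scoped ContDiff

noncomputable section

namespace SyncPDE

/-! ### Function spaces on the unit interval -/

/-- Lebesgue measure on `(0,1)`. -/
def unitMeasure : Measure ℝ := volume.restrict (Ioo (0 : ℝ) 1)

/-- `g` is a weak derivative of `w` on the open interval `(0,1)`: integration by parts against
every smooth function with compact support in `(0,1)`. -/
def IsWeakDeriv (w g : ℝ → ℝ) : Prop :=
  ∀ φ : ℝ → ℝ, ContDiff ℝ ∞ φ → HasCompactSupport φ → tsupport φ ⊆ Ioo (0 : ℝ) 1 →
    ∫ x, w x * deriv φ x ∂unitMeasure = - ∫ x, g x * φ x ∂unitMeasure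

/-- The `L²(0,1)`-seminorm. -/
def l2norm (w : ℝ → ℝ) : ENNReal := eLpNorm w 2 unitMeasure

/-- An element of `C(ℝ≥0; H²(0,1)) ∩ C¹(ℝ>0; L²(0,1))`, with its first two spatial derivatives and
its time derivative. The function and its first spatial derivative are given by their
representatives that are continuous on `[0,1]`, so that boundary values make sense.
Arguments are in the order `x`, `t`; only `x ∈ [0,1]`, `t ≥ 0` matter. -/
structure Trajectory where
  val : ℝ → ℝ → ℝ
  dx : ℝ → ℝ → ℝ
  dxx : ℝ → ℝ → ℝ
  dt : ℝ → ℝ → ℝ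
  continuousOn_val : ∀ t, 0 ≤ t → ContinuousOn (fun x => val x t) (Icc 0 1)
  continuousOn_dx : ∀ t, 0 ≤ t → ContinuousOn (fun x => dx x t) (Icc 0 1)
  memLp_dxx : ∀ t, 0 ≤ t → MemLp (fun x => dxx x t) 2 unitMeasure
  weakDeriv_val : ∀ t, 0 ≤ t → IsWeakDeriv (fun x => val x t) (fun x => dx x t)
  weakDeriv_dx : ∀ t, 0 ≤ t → IsWeakDeriv (fun x => dx x t) (fun x => dxx x t)
  tendsto_val : ∀ s, 0 ≤ s →
    Tendsto (fun t => l2norm (fun x => val x t - val x s)) (𝓝[Ici 0] s) (𝓝 0)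
  tendsto_dx : ∀ s, 0 ≤ s →
    Tendsto (fun t => l2norm (fun x => dx x t - dx x s)) (𝓝[Ici 0] s) (𝓝 0)
  tendsto_dxx : ∀ s, 0 ≤ s →
    Tendsto (fun t => l2norm (fun x => dxx x t - dxx x s)) (𝓝[Ici 0] s) (𝓝 0)
  memLp_dt : ∀ t, 0 < t → MemLp (fun x => dt x t) 2 unitMeasure
  hasDeriv_val : ∀ t, 0 < t →
    Tendsto (fun h => l2norm (fun x => h⁻¹ * (val x (t + h) - val x t) - dt x t))
      (𝓝[≠] 0) (𝓝 0)
  tendsto_dt : ∀ s, 0 < s →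
    Tendsto (fun t => l2norm (fun x => dt x t - dt x s)) (𝓝 s) (𝓝 0)

/-- A trajectory is used as the function `(x, t) ↦ u x t`. -/
instance : CoeFun Trajectory (fun _ => ℝ → ℝ → ℝ) := ⟨Trajectory.val⟩

/-- `u_t = α u_xx - λ u + f` on `(0,1) × ℝ>0`. -/
def SolvesHeat (α lam : ℝ) (f : ℝ → ℝ → ℝ) (u : Trajectory) : Prop :=
  ∀ t, 0 < t → ∀ᵐ x ∂unitMeasure, u.dt x t = α * u.dxx x t - lam * u x t + f x t

/-- The maximum norm of `h` on `S` (`h` continuous on the compact set `S` in all uses). -/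
def maxNorm {X : Type*} (S : Set X) (h : X → ℝ) : ℝ := sSup ((fun x => |h x|) '' S)

/-- `‖h‖_{C([0,1])}` -/
def normSpace (h : ℝ → ℝ) : ℝ := maxNorm (Icc (0 : ℝ) 1) h

/-- `‖h‖_{C([0,t])}` -/
def normTime (t : ℝ) (h : ℝ → ℝ) : ℝ := maxNorm (Icc (0 : ℝ) t) h

/-- `‖h‖_{C([0,1] × [0,t])}` -/
def normCyl (t : ℝ) (h : ℝ → ℝ → ℝ) : ℝ :=
  maxNorm (Icc (0 : ℝ) 1 ×ˢ Icc (0 : ℝ) t) (fun p => h p.1 p.2)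

/-! ### Cyclic indices -/

/-- The representative in `{1, …, N}` of the integer `m` modulo `N`. -/
def cyc (N : ℕ) (m : ℤ) : ℕ := ((m - 1) % (N : ℤ)).toNat + 1

/-- Maximum over the agents `1, …, N`. -/
def maxAgents (N : ℕ) (F : ℕ → ℝ) : ℝ := sSup (F '' Icc 1 N)

/-- Maximum over the pairs of agents. -/
def maxPairs (N : ℕ) (F : ℕ → ℕ → ℝ) : ℝ :=
  sSup ((fun p : ℕ × ℕ => F p.1 p.2) '' (Icc 1 N ×ˢ Icc 1 N))

/-! ### The multi-agent system -/

/-- The data of the multi-agent system: plant constants, gains, disturbances, reference signal and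
(continuous) initial data. Agents carry the labels `1, …, N`. -/
structure Network where
  N : ℕ
  two_le_N : 2 ≤ N
  α : ℝ
  lam : ℝ
  l : ℝ
  α_pos : 0 < α
  lam_pos : 0 < lam
  l_pos : 0 < l
  /-- control gains -/
  k : ℕ → ℝ
  k_mem : ∀ i ∈ Icc 1 N, k i ∈ Ioo 0 l
  /-- unobservable in-domain disturbances -/
  f : ℕ → ℝ → ℝ → ℝ
  f_cont : ∀ i ∈ Icc 1 N, ContinuousOn (fun p : ℝ × ℝ => f i p.1 p.2) (Icc 0 1 ×ˢ Ici 0)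
  /-- observable Dirichlet boundary disturbances -/
  q : ℕ → ℝ → ℝ
  q_C1 : ∀ i ∈ Icc 1 N, ContDiffOn ℝ 1 (q i) (Ici 0)
  /-- unobservable implementation disturbances at the Dirichlet end -/
  d₀ : ℕ → ℝ → ℝ
  d₀_C1 : ∀ i ∈ Icc 1 N, ContDiffOn ℝ 1 (d₀ i) (Ici 0)
  /-- unobservable implementation disturbances at the Robin end -/
  d₁ : ℕ → ℝ → ℝ
  d₁_C1 : ∀ i ∈ Icc 1 N, ContDiffOn ℝ 1 (d₁ i) (Ici 0)
  /-- reference signal -/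
  r : ℝ → ℝ
  r_C1 : ContDiffOn ℝ 1 r (Ici 0)
  u₀ : ℕ → ℝ → ℝ
  uref₀ : ℝ → ℝ
  v₀ : ℕ → ℝ → ℝ
  qhat₀ : ℕ → ℝ → ℝ

namespace Network

/-- A solution of the closed loop: plants, reference system, auxiliary systems and observers,
under the disturbed control laws `U₀`, `U₁`. The initial values, being continuous on `[0,1]`,
are prescribed on `[0,1]`. -/
structure ClosedLoop (S : Network) where
  u : ℕ → Trajectory
  uref : Trajectory
  v : ℕ → Trajectory
  qhat : ℕ → Trajectory
  /-- control input at the Dirichlet end -/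
  U₀ : ℕ → ℝ → ℝ
  /-- control input at the Robin end -/
  U₁ : ℕ → ℝ → ℝ
  control₀ : ∀ i ∈ Icc 1 S.N, ∀ t, 0 < t → U₀ i t = S.r t - qhat i 0 t + S.d₀ i t
  control₁ : ∀ i ∈ Icc 1 S.N, ∀ t, 0 < t →
    U₁ i t = S.k i * (u (cyc S.N ((i : ℤ) - 1)) 1 t - uref 1 t) + S.d₁ i t
  u_pde : ∀ i ∈ Icc 1 S.N, SolvesHeat S.α S.lam (S.f i) (u i)
  u_left : ∀ i ∈ Icc 1 S.N, ∀ t, 0 < t → u i 0 t = S.q i t + U₀ i t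
  u_right : ∀ i ∈ Icc 1 S.N, ∀ t, 0 < t → (u i).dx 1 t = -S.l * u i 1 t + U₁ i t
  u_init : ∀ i ∈ Icc 1 S.N, ∀ x ∈ Icc (0 : ℝ) 1, u i x 0 = S.u₀ i x
  uref_pde : SolvesHeat S.α S.lam 0 uref
  uref_left : ∀ t, 0 < t → uref 0 t = S.r t
  uref_right : ∀ t, 0 < t → uref.dx 1 t = -S.l * uref 1 t
  uref_init : ∀ x ∈ Icc (0 : ℝ) 1, uref x 0 = S.uref₀ x
  v_pde : ∀ i ∈ Icc 1 S.N, SolvesHeat S.α S.lam 0 (v i)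
  v_left : ∀ i ∈ Icc 1 S.N, ∀ t, 0 < t → v i 0 t = U₀ i t
  v_right : ∀ i ∈ Icc 1 S.N, ∀ t, 0 < t → (v i).dx 1 t = -S.l * v i 1 t + U₁ i t
  v_init : ∀ i ∈ Icc 1 S.N, ∀ x ∈ Icc (0 : ℝ) 1, v i x 0 = S.v₀ i x
  qhat_pde : ∀ i ∈ Icc 1 S.N, SolvesHeat S.α S.lam 0 (qhat i)
  qhat_left : ∀ i ∈ Icc 1 S.N, ∀ t, 0 < t → (qhat i).dx 0 t = (u i).dx 0 t - (v i).dx 0 t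
  qhat_right : ∀ i ∈ Icc 1 S.N, ∀ t, 0 < t → (qhat i).dx 1 t = -S.l * qhat i 1 t
  qhat_init : ∀ i ∈ Icc 1 S.N, ∀ x ∈ Icc (0 : ℝ) 1, qhat i x 0 = S.qhat₀ i x

/-- The gain with cyclic index. -/
def kc (S : Network) (m : ℤ) : ℝ := S.k (cyc S.N m)

/-- `𝒩 = k₁ ⋯ k_N / l^N` -/
def loopGain (S : Network) : ℝ := (∏ i ∈ Finset.Icc 1 S.N, S.k i) / S.l ^ S.N

/-- `ℳ_i` -/
def Mcal (S : Network) (i : ℕ) : ℝ :=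
  1 + ∑ m ∈ Finset.Icc 1 i, (∏ r ∈ Finset.range m, S.kc ((i : ℤ) - r)) / S.l ^ m
    + ∑ m ∈ Finset.Icc (i + 1) (S.N - 1),
        ((∏ r ∈ Finset.range i, S.kc ((i : ℤ) - r)) *
          (∏ s ∈ Finset.range (m - i), S.kc ((S.N : ℤ) - s))) / S.l ^ m

/-- `𝒞_i = ℳ_i / (1 - 𝒩)` -/
def Ccal (S : Network) (i : ℕ) : ℝ := S.Mcal i / (1 - S.loopGain)

/-- `𝒞̃_i = 1 + (k_i / l) 𝒞_{i-1}` -/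
def Ctilde (S : Network) (i : ℕ) : ℝ := 1 + S.k i / S.l * S.Ccal (cyc S.N ((i : ℤ) - 1))

/-- `𝒦_{j,m}` -/
def Kcal (S : Network) (j m : ℕ) : ℝ :=
  (∏ r ∈ Finset.range j, S.kc ((j : ℤ) - r)) *
    (∏ s ∈ Finset.Icc 1 (m - j), S.kc ((S.N : ℤ) + 1 - s))

/-- `ℋ_{i,j}` -/
def Hcal (S : Network) (i j : ℕ) : ℝ :=
  |S.k i - S.k j| / S.l
    + ∑ m ∈ Finset.Icc 1 j,
        ((∏ r ∈ Finset.range m, S.kc ((j : ℤ) - r)) *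
          |S.kc ((i : ℤ) - m) - S.kc ((j : ℤ) - m)|) / S.l ^ (m + 1)
    + ∑ m ∈ Finset.Icc (j + 1) (S.N - 1),
        (S.Kcal j m * |S.kc ((i : ℤ) - m + S.N) - S.kc ((j : ℤ) - m + S.N)|) / S.l ^ (m + 1)

/-- `ℋ̃_{i,j}` -/
def Htilde (S : Network) (i j : ℕ) : ℝ :=
  S.k j * S.Hcal (cyc S.N ((i : ℤ) - 1)) (cyc S.N ((j : ℤ) - 1)) / (S.l * (1 - S.loopGain))
    + |S.k i - S.k j| / S.l

/-- `𝒟(t)`: size of the unobservable disturbances up to time `t`. -/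
def Dcal (S : Network) (σ t : ℝ) : ℝ :=
  2 / (S.lam - σ) * maxAgents S.N (fun i => normCyl t (S.f i))
    + maxAgents S.N (fun i => normTime t (S.d₀ i))
    + 1 / S.l * maxAgents S.N (fun i => normTime t (S.d₁ i))

/-- `𝒟̃(t)`: size of the differences of the unobservable disturbances up to time `t`. -/
def Dtilde (S : Network) (σ t : ℝ) : ℝ :=
  2 / (S.lam - σ) * maxPairs S.N (fun i j => normCyl t (fun x s => S.f i x s - S.f j x s))
    + maxPairs S.N (fun i j => normTime t (fun s => S.d₀ i s - S.d₀ j s))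
    + 1 / S.l * maxPairs S.N (fun i j => normTime t (fun s => S.d₁ i s - S.d₁ j s))

/-- Initial tracking error `ũ₀⁽ⁱ⁾`. -/
def trackErr₀ (S : Network) (i : ℕ) (x : ℝ) : ℝ := S.u₀ i x - S.uref₀ x

/-- Initial observer error `u₀⁽ⁱ⁾ - v₀⁽ⁱ⁾ - q̂₀⁽ⁱ⁾`. -/
def obsErr₀ (S : Network) (i : ℕ) (x : ℝ) : ℝ := S.u₀ i x - S.v₀ i x - S.qhat₀ i x

/-- Size of the initial errors of the agents. -/
def init (S : Network) : ℝ :=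
  maxAgents S.N (fun i => normSpace (S.trackErr₀ i))
    + maxAgents S.N (fun i => normSpace (S.obsErr₀ i))

/-- Size of the differences of the initial errors of the agents. -/
def initPairs (S : Network) : ℝ :=
  maxPairs S.N (fun i j => normSpace (fun x => S.trackErr₀ i x - S.trackErr₀ j x))
    + maxPairs S.N (fun i j => normSpace (fun x => S.obsErr₀ i x - S.obsErr₀ j x))

/-- Synchronization error `ũ⁽ⁱʲ⁾ = u⁽ⁱ⁾ - u⁽ʲ⁾` at time `t`. -/
def ClosedLoop.syncErr {S : Network} (X : S.ClosedLoop) (i j : ℕ) (t x : ℝ) : ℝ :=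
  X.u i x t - X.u j x t

end Network

end SyncPDE

end

/-! Put w_i = u_i - u_ref and p_i = u_i - v_i - q̂_i. By linearity p_i solves the heat equation with
source f_i, a homogeneous Neumann condition at 0 and a homogeneous Robin condition at 1, while w_i
has the same source, Dirichlet value p_i(0,t) + d₀ and Robin datum k_i w_{i-1}(1,t) + d₁. The
disturbance q_i and the reference have dropped out, and differences of two agents obey equations of
the same form.

The analytic core is a maximum principle with weight e^{σt} (`le_mul_exp`, `exp_mul_abs_le`). Once K
dominates the weighted data, K e^{-σt} is a supersolution, and Stampacchia truncation shows that the
squared L² norm of the positive part of z - K e^{-σt} cannot increase. Applied to p and then to w,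
this gives `weightedNorm_le_of_cascade`, where the Robin datum enters divided by l.

The rest is algebra on the cycle. The weighted norms satisfy y_i ≤ E + (k_i/l) y_{i-1}. For pairs,
the splitting k_i w_{i-1} - k_j w_{j-1} = (k_i - k_j) w_{i-1} + k_j (w_{i-1} - w_{j-1}) gives a
recursion from (i,j) to (i-1,j-1) whose extra source is controlled by the bound for single agents.
After N steps the recursion is back at its start with the factor 𝒩 < 1, which is absorbed on the
left (`le_of_cyclic_pairs`); one further use of the recursion produces 𝒞̃ and ℋ̃
(`le_Htilde_of_cyclic_pairs`). Multiplication by e^{-σT} yields the estimate, and the other two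
claims follow by bounding 𝒟 and 𝒟̃. -/

noncomputable section

namespace SyncPDE

/-! ### Weak derivatives on the unit interval -/

instance : IsProbabilityMeasure unitMeasure := ⟨by simp [unitMeasure]⟩

theorem integral_unitMeasure (f : ℝ → ℝ) : ∫ x, f x ∂unitMeasure = ∫ x in (0 : ℝ)..1, f x := by
  rw [intervalIntegral.integral_of_le zero_le_one, integral_Ioc_eq_integral_Ioo, unitMeasure]

theorem integrable_unitMeasure_iff {f : ℝ → ℝ} :
    Integrable f unitMeasure ↔ IntervalIntegrable f volume 0 1 := by
  rw [intervalIntegrable_iff_integrableOn_Ioo_of_le zero_le_one]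
  rfl

theorem ae_unitMeasure_iff {p : ℝ → Prop} :
    (∀ᵐ x ∂unitMeasure, p x) ↔ ∀ᵐ x, x ∈ Ioo (0 : ℝ) 1 → p x :=
  ae_restrict_iff' measurableSet_Ioo

theorem memLp_of_continuousOn {w : ℝ → ℝ} (hw : ContinuousOn w (Icc 0 1)) (p : ENNReal) :
    MemLp w p unitMeasure := by
  obtain ⟨C, hC⟩ := isCompact_Icc.exists_bound_of_continuousOn hw
  refine MemLp.of_bound (C := C) ?_ ?_
  · exact (hw.mono Ioo_subset_Icc_self).aestronglyMeasurable measurableSet_Ioo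
  · exact ae_unitMeasure_iff.2 (.of_forall fun x hx => hC x (Ioo_subset_Icc_self hx))

theorem eqOn_of_ae_eq {v w : ℝ → ℝ} (hv : ContinuousOn v (Icc 0 1)) (hw : ContinuousOn w (Icc 0 1))
    (h : v =ᵐ[unitMeasure] w) : EqOn v w (Icc 0 1) := by
  have h1 : EqOn v w (Ioo 0 1) :=
    Measure.eqOn_open_of_ae_eq h isOpen_Ioo (hv.mono Ioo_subset_Icc_self)
      (hw.mono Ioo_subset_Icc_self)
  exact h1.of_subset_closure hv hw Ioo_subset_Icc_self (by simp [closure_Ioo])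

theorem tsupport_bounds {ψ : ℝ → ℝ} (hc : HasCompactSupport ψ) (hs : tsupport ψ ⊆ Ioo 0 1) :
    ∃ a b : ℝ, 0 < a ∧ a < b ∧ b < 1 ∧ ∀ x, x ∉ Icc a b → ψ x = 0 := by
  rcases (tsupport ψ).eq_empty_or_nonempty with he | hne
  · refine ⟨1/4, 1/2, by norm_num, by norm_num, by norm_num, fun x _ => ?_⟩
    exact image_eq_zero_of_notMem_tsupport (by simp [he])
  · obtain ⟨a, ha, ha'⟩ := hc.isCompact.exists_isLeast hne
    obtain ⟨b, hb, hb'⟩ := hc.isCompact.exists_isGreatest hne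
    have := (hs ha).1
    have := (hs hb).2
    have := (hs hb).1
    have := (hs ha).2
    -- The right end is moved halfway to 1 so that a < b stays strict even if the support is a
    -- single point.
    refine ⟨a, (b + 1) / 2, by linarith, ?_, by linarith, fun x hx => ?_⟩
    · have := ha' hb; linarith
    · refine image_eq_zero_of_notMem_tsupport fun hx' => hx ⟨ha' hx', ?_⟩
      have := hb' hx'; linarith

/-- A smooth compactly supported function on `(0,1)` with vanishing integral is the derivative of
a smooth compactly supported function on `(0,1)`. -/
theorem exists_testFunction_deriv_eq {ψ : ℝ → ℝ} (hψ : ContDiff ℝ ∞ ψ) (hc : HasCompactSupport ψ)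
    (hs : tsupport ψ ⊆ Ioo 0 1) (h0 : ∫ x in (0 : ℝ)..1, ψ x = 0) :
    ∃ φ : ℝ → ℝ, ContDiff ℝ ∞ φ ∧ HasCompactSupport φ ∧ tsupport φ ⊆ Ioo 0 1 ∧ deriv φ = ψ := by
  obtain ⟨a, b, ha, hab, hb, hz⟩ := tsupport_bounds hc hs
  have hψc := hψ.continuous
  have hint : ∀ x y, IntervalIntegrable ψ volume x y := fun x y => hψc.intervalIntegrable x y
  have hd : deriv (fun x => ∫ y in (0 : ℝ)..x, ψ y) = ψ := by
    ext x
    exact hψc.deriv_integral ψ 0 x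
  have hzero : ∀ x, x ∉ Icc a b → ∫ y in (0 : ℝ)..x, ψ y = 0 := by
    intro x hx
    rw [mem_Icc, not_and_or, not_le, not_le] at hx
    rcases hx with hx | hx
    · refine (intervalIntegral.integral_congr (g := fun _ => 0) fun y hy => ?_).trans (by simp)
      refine hz y fun hy' => ?_
      rcases le_total 0 x with h | h
      · rw [uIcc_of_le h] at hy; linarith [hy.2, hy'.1]
      · rw [uIcc_of_ge h] at hy; linarith [hy.2, hy'.1]
    -- To the right of the support the primitive equals the integral over [0,1], which is where the
    -- vanishing mean is needed.
    · rw [← intervalIntegral.integral_add_adjacent_intervals (hint 0 1) (hint 1 x), h0, zero_add]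
      refine (intervalIntegral.integral_congr (g := fun _ => 0) fun y hy => ?_).trans (by simp)
      refine hz y fun hy' => ?_
      rcases le_total 1 x with h | h
      · rw [uIcc_of_le h] at hy; linarith [hy.1, hy'.2]
      · rw [uIcc_of_ge h] at hy; linarith [hy.1, hy'.2]
  have hsub : tsupport (fun x => ∫ y in (0 : ℝ)..x, ψ y) ⊆ Icc a b :=
    closure_minimal (fun x hx => by_contra fun h => hx (hzero x h)) isClosed_Icc
  refine ⟨_, ?_, isCompact_Icc.of_isClosed_subset (isClosed_tsupport _) hsub,
    hsub.trans (Icc_subset_Ioo ha hb), hd⟩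
  rw [contDiff_infty_iff_deriv, hd]
  exact ⟨fun x => ((hψc.integral_hasStrictDerivAt 0 x).hasDerivAt).differentiableAt, hψ⟩

/-- A fixed bump of mass one: subtracting a multiple of it makes any test function mean-free, hence
the derivative of a test function. -/
theorem exists_testFunction_integral_eq_one :
    ∃ χ : ℝ → ℝ, ContDiff ℝ ∞ χ ∧ HasCompactSupport χ ∧ tsupport χ ⊆ Ioo 0 1 ∧
      ∫ x in (0 : ℝ)..1, χ x = 1 := by
  let f : ContDiffBump (1 / 2 : ℝ) := ⟨1 / 8, 1 / 4, by norm_num, by norm_num⟩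
  have hsub : tsupport (f.normed volume) ⊆ Icc (1 / 4) (3 / 4) := by
    rw [f.tsupport_normed_eq, Real.closedBall_eq_Icc]
    norm_num [f]
  refine ⟨f.normed volume, f.contDiff_normed, f.hasCompactSupport_normed,
    hsub.trans (Icc_subset_Ioo (by norm_num) (by norm_num)), ?_⟩
  rw [intervalIntegral.integral_of_le zero_le_one, setIntegral_eq_integral_of_forall_compl_eq_zero]
  · exact f.integral_normed
  · intro x hx
    refine image_eq_zero_of_notMem_tsupport fun h => hx ?_
    have := hsub h
    exact ⟨by linarith [this.1], by linarith [this.2]⟩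

/-- du Bois-Reymond: a continuous function with zero weak derivative is constant. -/
theorem exists_eq_const_of_integral_mul_deriv_eq_zero {h : ℝ → ℝ} (hc : ContinuousOn h (Icc 0 1))
    (h0 : ∀ φ : ℝ → ℝ, ContDiff ℝ ∞ φ → HasCompactSupport φ → tsupport φ ⊆ Ioo (0 : ℝ) 1 →
      ∫ x in (0 : ℝ)..1, h x * deriv φ x = 0) :
    ∃ c, ∀ x ∈ Icc (0 : ℝ) 1, h x = c := by
  obtain ⟨χ₀, hχ₀, hχ₀c, hχ₀s, hχ₀i⟩ := exists_testFunction_integral_eq_one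
  have hhi : IntervalIntegrable h volume 0 1 := hc.intervalIntegrable_of_Icc zero_le_one
  set c := ∫ x in (0 : ℝ)..1, h x * χ₀ x with hcdef
  -- Testing with the primitive of χ - (∫ χ) χ₀ shows that h - c is orthogonal to every test
  -- function χ.
  have key : ∀ χ : ℝ → ℝ, ContDiff ℝ ∞ χ → HasCompactSupport χ → tsupport χ ⊆ Ioo (0 : ℝ) 1 →
      ∫ x, χ x • (h x - c) = 0 := by
    intro χ hχ hχc hχs
    set m := ∫ x in (0 : ℝ)..1, χ x
    have hsupp : tsupport (fun x => χ x - m * χ₀ x) ⊆ Ioo 0 1 := by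
      have h1 : tsupport (fun x => m * χ₀ x) ⊆ tsupport χ₀ :=
        closure_mono fun x hx h' => hx (by simp [h'])
      exact (tsupport_sub χ (fun x => m * χ₀ x)).trans (union_subset hχs (h1.trans hχ₀s))
    have hcont : ContDiff ℝ ∞ (fun x => χ x - m * χ₀ x) := hχ.sub (contDiff_const.mul hχ₀)
    obtain ⟨φ, hφ, hφc, hφs, hφd⟩ := exists_testFunction_deriv_eq hcont
      (hχc.sub (hχ₀c.mul_left)) hsupp (by
        rw [intervalIntegral.integral_sub (hχ.continuous.intervalIntegrable _ _)
          ((hχ₀.continuous.const_mul m).intervalIntegrable _ _),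
          intervalIntegral.integral_const_mul, hχ₀i]
        simp [m])
    have h1 := h0 φ hφ hφc hφs
    rw [hφd] at h1
    have i1 : IntervalIntegrable (fun x => h x * χ x) volume 0 1 :=
      hhi.mul_continuousOn hχ.continuous.continuousOn
    have i2 : IntervalIntegrable (fun x => h x * χ₀ x) volume 0 1 :=
      hhi.mul_continuousOn hχ₀.continuous.continuousOn
    have h2 : ∫ x in (0 : ℝ)..1, h x * (χ x - m * χ₀ x)
        = (∫ x in (0 : ℝ)..1, h x * χ x) - m * c := by
      rw [hcdef, ← intervalIntegral.integral_const_mul, ← intervalIntegral.integral_sub i1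
        (i2.const_mul m)]
      exact intervalIntegral.integral_congr fun x _ => by ring
    have h3 : ∫ x, χ x • (h x - c) = ∫ x in (0 : ℝ)..1, (h x * χ x - c * χ x) := by
      rw [intervalIntegral.integral_of_le zero_le_one,
        setIntegral_eq_integral_of_forall_compl_eq_zero]
      · exact integral_congr_ae (.of_forall fun x => by simp only [smul_eq_mul]; ring)
      · intro x hx
        rw [image_eq_zero_of_notMem_tsupport fun h' => hx (Ioo_subset_Ioc_self (hχs h'))]
        ring
    rw [h3, intervalIntegral.integral_sub i1
      ((hχ.continuous.const_mul c).intervalIntegrable _ _),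
      intervalIntegral.integral_const_mul]
    linarith [h2.symm.trans h1]
  have hae := isOpen_Ioo.ae_eq_zero_of_integral_contDiff_smul_eq_zero
    (f := fun x => h x - c) (μ := volume) (U := Ioo (0 : ℝ) 1)
    (((hc.sub continuousOn_const).mono Ioo_subset_Icc_self).locallyIntegrableOn measurableSet_Ioo)
    (fun g hg hgc hgs => key g hg hgc hgs)
  refine ⟨c, eqOn_of_ae_eq hc continuousOn_const ?_⟩
  exact ae_unitMeasure_iff.2 (hae.mono fun x hx hx' => sub_eq_zero.1 (hx hx'))

/-- The fundamental theorem of calculus for weak derivatives. -/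
theorem IsWeakDeriv.eq_add_integral {w g : ℝ → ℝ} (h : IsWeakDeriv w g)
    (hw : ContinuousOn w (Icc 0 1)) (hg : Integrable g unitMeasure) :
    ∀ x ∈ Icc (0 : ℝ) 1, w x = w 0 + ∫ y in (0 : ℝ)..x, g y := by
  have hgi := integrable_unitMeasure_iff.1 hg
  have hac := hgi.absolutelyContinuousOnInterval_intervalIntegral (c := 0) left_mem_uIcc
  have hGc : ContinuousOn (fun x => ∫ y in (0 : ℝ)..x, g y) (Icc 0 1) := by
    simpa [uIcc_of_le] using hac.continuousOn
  obtain ⟨c, hc⟩ := exists_eq_const_of_integral_mul_deriv_eq_zero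
    (h := fun x => w x - ∫ y in (0 : ℝ)..x, g y) (hw.sub hGc) (by
    intro φ hφ hφc hφs
    have hφac : AbsolutelyContinuousOnInterval φ 0 1 :=
      (hφ.of_le (by exact_mod_cast le_top)).contDiffOn.absolutelyContinuousOnInterval
    -- The primitive of g is only absolutely continuous. Both boundary terms vanish: φ is zero at 1
    -- and the primitive is zero at 0.
    have h1 := hac.integral_mul_deriv_eq_deriv_mul hφac
    have hφ1 : φ 1 = 0 := image_eq_zero_of_notMem_tsupport fun h' => by simpa using hφs h'
    have h2 : ∫ x in (0 : ℝ)..1, deriv (fun x => ∫ y in (0 : ℝ)..x, g y) x * φ x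
        = ∫ x in (0 : ℝ)..1, g x * φ x := by
      refine intervalIntegral.integral_congr_ae ?_
      filter_upwards [hgi.ae_hasDerivAt_integral] with x hx hx'
      rw [(hx (uIoc_subset_uIcc hx') 0 left_mem_uIcc).deriv]
    have h3 := h φ hφ hφc hφs
    rw [integral_unitMeasure, integral_unitMeasure] at h3
    have hd : Continuous (deriv φ) := hφ.continuous_deriv (by exact_mod_cast le_top)
    have i1 : IntervalIntegrable (fun x => w x * deriv φ x) volume 0 1 :=
      (hw.mul hd.continuousOn).intervalIntegrable_of_Icc zero_le_one
    have i2 : IntervalIntegrable (fun x => (∫ y in (0 : ℝ)..x, g y) * deriv φ x) volume 0 1 :=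
      (hGc.mul hd.continuousOn).intervalIntegrable_of_Icc zero_le_one
    simp only [sub_mul]
    rw [intervalIntegral.integral_sub i1 i2, h1, h2, h3, hφ1]
    simp)
  intro x hx
  have e1 := hc x hx
  have e0 := hc 0 (left_mem_Icc.2 zero_le_one)
  simp only [intervalIntegral.integral_same] at e0
  linarith

/-! ### Integration by parts against the positive part -/

/-- Where w vanishes, its positive part has a minimum, so `deriv` is 0 there whether or not the
positive part is differentiable; elsewhere the product is 0 or d². -/
theorem deriv_max_zero_mul_nonneg {w : ℝ → ℝ} {x d : ℝ} (h : HasDerivAt w d x) :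
    0 ≤ deriv (fun y => max (w y) 0) x * d := by
  rcases lt_trichotomy (w x) 0 with hx | hx | hx
  · have : (fun y => max (w y) 0) =ᶠ[𝓝 x] fun _ => 0 :=
      (h.continuousAt.eventually_lt_const hx).mono fun y hy => max_eq_right hy.le
    simp [this.deriv_eq]
  · have : IsLocalMin (fun y => max (w y) 0) x := by
      refine .of_forall fun y => ?_
      simp [hx]
    simp [this.deriv_eq_zero]
  · have : (fun y => max (w y) 0) =ᶠ[𝓝 x] w :=
      (h.continuousAt.eventually_const_lt hx).mono fun y hy => max_eq_left hy.le
    rw [this.deriv_eq, h.deriv]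
    exact mul_self_nonneg d

/-- Integration by parts against the positive part, the gradient term being dropped. -/
theorem integral_max_zero_mul_le {w g g' : ℝ → ℝ} (hg : ContinuousOn g (Icc 0 1))
    (hw : ∀ x ∈ Icc (0 : ℝ) 1, w x = w 0 + ∫ y in (0 : ℝ)..x, g y)
    (hg' : Integrable g' unitMeasure)
    (hgg' : ∀ x ∈ Icc (0 : ℝ) 1, g x = g 0 + ∫ y in (0 : ℝ)..x, g' y) :
    ∫ x, max (w x) 0 * g' x ∂unitMeasure ≤ max (w 1) 0 * g 1 - max (w 0) 0 * g 0 := by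
  have hgi := integrable_unitMeasure_iff.1 hg'
  have hint : ∀ x ∈ Icc (0 : ℝ) 1, IntervalIntegrable g volume 0 x := fun x hx =>
    (hg.mono (Icc_subset_Icc_right hx.2)).intervalIntegrable_of_Icc hx.1
  obtain ⟨C, hC⟩ := isCompact_Icc.exists_bound_of_continuousOn hg
  have hC0 : 0 ≤ C := (norm_nonneg _).trans (hC 0 (left_mem_Icc.2 zero_le_one))
  -- The bound on g makes w Lipschitz, and the positive part inherits this; that is enough
  -- regularity for the product rule.
  have hlip : LipschitzOnWith ⟨C, hC0⟩ w (uIcc 0 1) := by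
    refine LipschitzOnWith.of_dist_le_mul fun x hx y hy => ?_
    rw [uIcc_of_le zero_le_one] at hx hy
    rw [dist_eq_norm, dist_eq_norm, hw x hx, hw y hy, add_sub_add_left_eq_sub,
      intervalIntegral.integral_interval_sub_left (hint x hx) (hint y hy)]
    refine intervalIntegral.norm_integral_le_of_norm_le_const fun z hz => hC z ?_
    have h1 := uIoc_subset_uIcc hz
    exact (ordConnected_Icc.uIcc_subset hy hx) h1
  have hpac : AbsolutelyContinuousOnInterval (fun x => max (w x) 0) 0 1 :=
    ((LipschitzWith.id.max_const 0).comp_lipschitzOnWith hlip).absolutelyContinuousOnInterval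
  have hGac : AbsolutelyContinuousOnInterval (fun x => g 0 + ∫ y in (0 : ℝ)..x, g' y) 0 1 :=
    (contDiffOn_const.absolutelyContinuousOnInterval).fun_add
      (hgi.absolutelyContinuousOnInterval_intervalIntegral (c := 0) left_mem_uIcc)
  have h1 := hpac.integral_mul_deriv_eq_deriv_mul hGac
  have h2 : ∫ x, max (w x) 0 * g' x ∂unitMeasure
      = ∫ x in (0 : ℝ)..1, max (w x) 0 * deriv (fun x => g 0 + ∫ y in (0 : ℝ)..x, g' y) x := by
    rw [integral_unitMeasure]
    refine intervalIntegral.integral_congr_ae ?_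
    filter_upwards [hgi.ae_hasDerivAt_integral] with x hx hx'
    rw [((hx (uIoc_subset_uIcc hx') 0 left_mem_uIcc).const_add (g 0)).deriv]
  have h3 : 0 ≤ ∫ x in (0 : ℝ)..1, deriv (fun y => max (w y) 0) x *
      (g 0 + ∫ y in (0 : ℝ)..x, g' y) := by
    rw [← integral_unitMeasure]
    refine integral_nonneg_of_ae (ae_unitMeasure_iff.2 (.of_forall fun x hx => ?_))
    have hx' := Ioo_subset_Icc_self hx
    simp only [Pi.zero_apply, ← hgg' x hx']
    refine deriv_max_zero_mul_nonneg ?_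
    have hga : ContinuousAt g x := hg.continuousAt (Icc_mem_nhds hx.1 hx.2)
    have hd : HasDerivAt (fun x => w 0 + ∫ y in (0 : ℝ)..x, g y) (g x) x := by
      refine (intervalIntegral.integral_hasDerivAt_right (hint x hx') ?_ hga).const_add (w 0)
      exact (hg.mono Ioo_subset_Icc_self).stronglyMeasurableAtFilter isOpen_Ioo x hx
    exact hd.congr_of_eventuallyEq
      (eventually_of_mem (Ioo_mem_nhds hx.1 hx.2) fun y hy => hw y (Ioo_subset_Icc_self hy))
  have e1 := hgg' 1 (right_mem_Icc.2 zero_le_one)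
  rw [h2, h1, ← e1]
  simp only [intervalIntegral.integral_same, add_zero]
  linarith

/-! ### The squared norm of the positive part is differentiable on L² -/

section L2

variable {Ω : Type*} {mΩ : MeasurableSpace Ω} {μ : Measure Ω}

/-- This integrates the scalar inequality |((a+b)⁺)² - (a⁺)² - 2a⁺b| ≤ b², which is checked by the
signs of a and a + b. The quadratic remainder gives the Fréchet derivative. -/
theorem norm_sq_posPart_sub_le (w d : Lp ℝ 2 μ) :
    ‖‖Lp.posPart (w + d)‖ ^ 2 - ‖Lp.posPart w‖ ^ 2 - 2 * inner ℝ (Lp.posPart w) d‖ ≤ ‖d‖ ^ 2 := by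
  simp only [← real_inner_self_eq_norm_sq, L2.inner_def]
  have hi : ∀ u v : Lp ℝ 2 μ, Integrable (fun x => inner ℝ (u x) (v x)) μ :=
    fun u v => L2.integrable_inner u v
  rw [← integral_const_mul, ← integral_sub (hi _ _) (hi _ _),
    ← integral_sub (by exact (hi _ _).sub (hi _ _)) ((hi _ _).const_mul 2)]
  refine norm_integral_le_of_norm_le (L2.integrable_inner _ _) ?_
  filter_upwards [Lp.coeFn_posPart (w + d), Lp.coeFn_posPart w, Lp.coeFn_add w d] with x h1 h2 h3
  rw [h1, h2, h3, Pi.add_apply]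
  simp only [RCLike.inner_apply, conj_trivial, Real.norm_eq_abs]
  rw [abs_le]
  rcases max_cases (w x + d x) 0 with ⟨ha, hb⟩ | ⟨ha, hb⟩ <;>
  rcases max_cases (w x) 0 with ⟨hc, hd⟩ | ⟨hc, hd⟩ <;> rw [ha, hc] <;>
  constructor <;> nlinarith [mul_self_nonneg (d x), mul_self_nonneg (w x + d x)]

theorem hasFDerivAt_norm_posPart_sq (w : Lp ℝ 2 μ) :
    HasFDerivAt (fun v : Lp ℝ 2 μ => ‖Lp.posPart v‖ ^ 2)
      ((2 : ℝ) • innerSL ℝ (Lp.posPart w)) w := by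
  rw [hasFDerivAt_iff_isLittleO_nhds_zero]
  refine (Asymptotics.IsBigO.of_bound 1 (.of_forall fun d => ?_)).trans_isLittleO
    (Asymptotics.isLittleO_norm_pow_id one_lt_two)
  simpa using norm_sq_posPart_sub_le w d

end L2

/-! ### Linear combinations of trajectories -/

theorem IsWeakDeriv.lincomb {w v g h : ℝ → ℝ} (a b : ℝ) (hw : IsWeakDeriv w g)
    (hv : IsWeakDeriv v h) (iw : Integrable w unitMeasure) (iv : Integrable v unitMeasure)
    (ig : Integrable g unitMeasure) (ih : Integrable h unitMeasure) :
    IsWeakDeriv (fun x => a * w x + b * v x) (fun x => a * g x + b * h x) := by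
  intro φ hφ hφc hφs
  have hd : Continuous (deriv φ) := hφ.continuous_deriv (by exact_mod_cast le_top)
  have key : ∀ (w v ψ : ℝ → ℝ), Integrable w unitMeasure → Integrable v unitMeasure →
      Continuous ψ → ∫ x, (a * w x + b * v x) * ψ x ∂unitMeasure
        = a * (∫ x, w x * ψ x ∂unitMeasure) + b * ∫ x, v x * ψ x ∂unitMeasure := by
    intro w v ψ iw iv hψ
    have i1 : Integrable (fun x => w x * ψ x) unitMeasure := integrable_unitMeasure_iff.2
      ((integrable_unitMeasure_iff.1 iw).mul_continuousOn hψ.continuousOn)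
    have i2 : Integrable (fun x => v x * ψ x) unitMeasure := integrable_unitMeasure_iff.2
      ((integrable_unitMeasure_iff.1 iv).mul_continuousOn hψ.continuousOn)
    rw [← integral_const_mul, ← integral_const_mul,
      ← integral_add (i1.const_mul a) (i2.const_mul b)]
    exact integral_congr_ae (.of_forall fun x => by ring)
  rw [key w v _ iw iv hd, key g h _ ig ih hφ.continuous, hw φ hφ hφc hφs, hv φ hφ hφc hφs]
  ring

theorem tendsto_l2norm_lincomb {ι : Type*} {m : Filter ι} {F G : ι → ℝ → ℝ} (a b : ℝ)
    (hF : Tendsto (fun t => l2norm (F t)) m (𝓝 0)) (hG : Tendsto (fun t => l2norm (G t)) m (𝓝 0))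
    (mF : ∀ᶠ t in m, AEStronglyMeasurable (F t) unitMeasure)
    (mG : ∀ᶠ t in m, AEStronglyMeasurable (G t) unitMeasure) :
    Tendsto (fun t => l2norm (fun x => a * F t x + b * G t x)) m (𝓝 0) := by
  have h0 : Tendsto (fun t => ‖a‖ₑ * l2norm (F t) + ‖b‖ₑ * l2norm (G t)) m (𝓝 0) := by
    have := (ENNReal.Tendsto.const_mul (a := ‖a‖ₑ) hF (.inr enorm_ne_top)).add
      (ENNReal.Tendsto.const_mul (a := ‖b‖ₑ) hG (.inr enorm_ne_top))
    simpa using this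
  refine tendsto_of_tendsto_of_tendsto_of_le_of_le' tendsto_const_nhds h0
    (.of_forall fun _ => zero_le) ?_
  filter_upwards [mF, mG] with t h1 h2
  refine (eLpNorm_add_le (h1.const_mul a) (h2.const_mul b) one_le_two).trans ?_
  exact add_le_add (eLpNorm_const_smul_le (c := a) (f := F t))
    (eLpNorm_const_smul_le (c := b) (f := G t))

namespace Trajectory

theorem memLp_val (u : Trajectory) {t : ℝ} (ht : 0 ≤ t) : MemLp (fun x => u x t) 2 unitMeasure :=
  memLp_of_continuousOn (u.continuousOn_val t ht) 2

theorem memLp_dx (u : Trajectory) {t : ℝ} (ht : 0 ≤ t) :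
    MemLp (fun x => u.dx x t) 2 unitMeasure :=
  memLp_of_continuousOn (u.continuousOn_dx t ht) 2

theorem val_eq (u : Trajectory) {t : ℝ} (ht : 0 ≤ t) :
    ∀ x ∈ Icc (0 : ℝ) 1, u x t = u 0 t + ∫ y in (0 : ℝ)..x, u.dx y t :=
  (u.weakDeriv_val t ht).eq_add_integral (u.continuousOn_val t ht)
    ((u.memLp_dx ht).integrable one_le_two)

theorem dx_eq (u : Trajectory) {t : ℝ} (ht : 0 ≤ t) :
    ∀ x ∈ Icc (0 : ℝ) 1, u.dx x t = u.dx 0 t + ∫ y in (0 : ℝ)..x, u.dxx y t :=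
  (u.weakDeriv_dx t ht).eq_add_integral (u.continuousOn_dx t ht)
    ((u.memLp_dxx t ht).integrable one_le_two)

theorem eventually_add_pos {t : ℝ} (ht : 0 < t) : ∀ᶠ h in 𝓝[≠] (0 : ℝ), 0 ≤ t + h := by
  refine nhdsWithin_le_nhds ?_
  filter_upwards [lt_mem_nhds (neg_lt_zero.2 ht)] with h hh
  linarith

/-- Linear combinations of trajectories. -/
def lincomb (a b : ℝ) (u v : Trajectory) : Trajectory where
  val x t := a * u x t + b * v x t
  dx x t := a * u.dx x t + b * v.dx x t
  dxx x t := a * u.dxx x t + b * v.dxx x t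
  dt x t := a * u.dt x t + b * v.dt x t
  continuousOn_val t ht :=
    ((u.continuousOn_val t ht).const_mul a).add ((v.continuousOn_val t ht).const_mul b)
  continuousOn_dx t ht :=
    ((u.continuousOn_dx t ht).const_mul a).add ((v.continuousOn_dx t ht).const_mul b)
  memLp_dxx t ht := ((u.memLp_dxx t ht).const_mul a).add ((v.memLp_dxx t ht).const_mul b)
  weakDeriv_val t ht := (u.weakDeriv_val t ht).lincomb a b (v.weakDeriv_val t ht)
    ((u.memLp_val ht).integrable one_le_two) ((v.memLp_val ht).integrable one_le_two)
    ((u.memLp_dx ht).integrable one_le_two) ((v.memLp_dx ht).integrable one_le_two)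
  weakDeriv_dx t ht := (u.weakDeriv_dx t ht).lincomb a b (v.weakDeriv_dx t ht)
    ((u.memLp_dx ht).integrable one_le_two) ((v.memLp_dx ht).integrable one_le_two)
    ((u.memLp_dxx t ht).integrable one_le_two) ((v.memLp_dxx t ht).integrable one_le_two)
  tendsto_val s hs := by
    have := tendsto_l2norm_lincomb a b (u.tendsto_val s hs) (v.tendsto_val s hs)
      (eventually_mem_nhdsWithin.mono fun t ht => ((u.memLp_val ht).sub (u.memLp_val hs)).1)
      (eventually_mem_nhdsWithin.mono fun t ht => ((v.memLp_val ht).sub (v.memLp_val hs)).1)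
    refine this.congr fun t => congrArg l2norm (funext fun x => ?_)
    ring
  tendsto_dx s hs := by
    have := tendsto_l2norm_lincomb a b (u.tendsto_dx s hs) (v.tendsto_dx s hs)
      (eventually_mem_nhdsWithin.mono fun t ht => ((u.memLp_dx ht).sub (u.memLp_dx hs)).1)
      (eventually_mem_nhdsWithin.mono fun t ht => ((v.memLp_dx ht).sub (v.memLp_dx hs)).1)
    refine this.congr fun t => congrArg l2norm (funext fun x => ?_)
    ring
  tendsto_dxx s hs := by
    have := tendsto_l2norm_lincomb a b (u.tendsto_dxx s hs) (v.tendsto_dxx s hs)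
      (eventually_mem_nhdsWithin.mono fun t ht => ((u.memLp_dxx t ht).sub (u.memLp_dxx s hs)).1)
      (eventually_mem_nhdsWithin.mono fun t ht => ((v.memLp_dxx t ht).sub (v.memLp_dxx s hs)).1)
    refine this.congr fun t => congrArg l2norm (funext fun x => ?_)
    ring
  memLp_dt t ht := ((u.memLp_dt t ht).const_mul a).add ((v.memLp_dt t ht).const_mul b)
  hasDeriv_val t ht := by
    have hm : ∀ w : Trajectory, ∀ᶠ h in 𝓝[≠] (0 : ℝ), AEStronglyMeasurable
        (fun x => h⁻¹ * (w x (t + h) - w x t) - w.dt x t) unitMeasure := fun w =>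
      (eventually_add_pos ht).mono fun h hh =>
        (((w.memLp_val hh).sub (w.memLp_val ht.le)).const_mul h⁻¹ |>.sub (w.memLp_dt t ht)).1
    have := tendsto_l2norm_lincomb a b (u.hasDeriv_val t ht) (v.hasDeriv_val t ht) (hm u) (hm v)
    refine this.congr fun t => congrArg l2norm (funext fun x => ?_)
    ring
  tendsto_dt s hs := by
    have := tendsto_l2norm_lincomb a b (u.tendsto_dt s hs) (v.tendsto_dt s hs)
      ((lt_mem_nhds hs).mono fun t ht => ((u.memLp_dt t ht).sub (u.memLp_dt s hs)).1)
      ((lt_mem_nhds hs).mono fun t ht => ((v.memLp_dt t ht).sub (v.memLp_dt s hs)).1)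
    refine this.congr fun t => congrArg l2norm (funext fun x => ?_)
    ring

@[simp] theorem lincomb_val (a b : ℝ) (u v : Trajectory) (x t : ℝ) :
    lincomb a b u v x t = a * u x t + b * v x t := rfl

@[simp] theorem lincomb_dx (a b : ℝ) (u v : Trajectory) (x t : ℝ) :
    (lincomb a b u v).dx x t = a * u.dx x t + b * v.dx x t := rfl

end Trajectory

theorem SolvesHeat.lincomb {α lam : ℝ} {f g : ℝ → ℝ → ℝ} {u v : Trajectory} (a b : ℝ)
    (hu : SolvesHeat α lam f u) (hv : SolvesHeat α lam g v) :
    SolvesHeat α lam (fun x t => a * f x t + b * g x t) (Trajectory.lincomb a b u v) := by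
  intro t ht
  filter_upwards [hu t ht, hv t ht] with x h1 h2
  simp only [Trajectory.lincomb, h1, h2]
  ring

/-! ### Uniform bounds and the L²-valued curve of a trajectory -/

/-- The Sobolev embedding of `H¹(0,1)` into `C([0,1])`. -/
theorem abs_le_l2norm_add {h g : ℝ → ℝ} (hh : MemLp h 2 unitMeasure) (hg : MemLp g 2 unitMeasure)
    (hhg : ∀ x ∈ Icc (0 : ℝ) 1, h x = h 0 + ∫ y in (0 : ℝ)..x, g y) :
    ∀ x ∈ Icc (0 : ℝ) 1, |h x| ≤ (l2norm h).toReal + (l2norm g).toReal := by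
  intro x hx
  have hgi := integrable_unitMeasure_iff.1 (hg.integrable one_le_two)
  have hint : ∀ x ∈ Icc (0 : ℝ) 1, IntervalIntegrable g volume 0 x := fun x hx =>
    hgi.mono_set (by rw [uIcc_of_le hx.1, uIcc_of_le zero_le_one]; exact Icc_subset_Icc_right hx.2)
  have l1 : ∀ {k : ℝ → ℝ}, MemLp k 2 unitMeasure →
      ∫ y, |k y| ∂unitMeasure ≤ (l2norm k).toReal := by
    intro k hk
    have := integral_norm_eq_lintegral_enorm hk.1
    simp only [Real.norm_eq_abs] at this
    rw [this, ← eLpNorm_one_eq_lintegral_enorm]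
    exact ENNReal.toReal_mono hk.2.ne (eLpNorm_le_eLpNorm_of_exponent_le one_le_two hk.1)
  -- This bound is averaged over y below, the measure having mass one.
  have hdiff : ∀ y ∈ Icc (0 : ℝ) 1, |h x| ≤ |h y| + ∫ y, |g y| ∂unitMeasure := by
    intro y hy
    have e : h x - h y = ∫ z in y..x, g z := by
      rw [hhg x hx, hhg y hy, add_sub_add_left_eq_sub,
        intervalIntegral.integral_interval_sub_left (hint x hx) (hint y hy)]
    have h1 : |h x - h y| ≤ ∫ y, |g y| ∂unitMeasure := by
      simp only [← Real.norm_eq_abs]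
      rw [e, integral_unitMeasure, intervalIntegral.integral_of_le zero_le_one]
      refine intervalIntegral.norm_integral_le_integral_norm_uIoc.trans ?_
      refine setIntegral_mono_set ?_ (.of_forall fun _ => norm_nonneg _) ?_
      · exact ((intervalIntegrable_iff_integrableOn_Ioc_of_le zero_le_one).1 hgi).norm
      · refine LE.le.eventuallyLE fun z hz => ?_
        have := le_min hy.1 hx.1
        have := max_le hy.2 hx.2
        exact ⟨by linarith [hz.1], by linarith [hz.2]⟩
    linarith [abs_sub_abs_le_abs_sub (h x) (h y)]
  have hi : Integrable (fun y => |h y|) unitMeasure := (hh.integrable one_le_two).abs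
  have h2 : ∫ _, |h x| ∂unitMeasure
      ≤ ∫ y, (|h y| + ∫ y, |g y| ∂unitMeasure) ∂unitMeasure := by
    refine integral_mono_ae (integrable_const _) (hi.add (integrable_const _)) ?_
    exact ae_unitMeasure_iff.2 (.of_forall fun y hy => hdiff y (Ioo_subset_Icc_self hy))
  rw [integral_add hi (integrable_const _)] at h2
  simp only [integral_const, probReal_univ, smul_eq_mul, one_mul] at h2
  linarith [l1 hh, l1 hg]

namespace Trajectory

/-- Continuity in time of both the values and the first space derivatives in L² becomes uniform
convergence in x through the Sobolev embedding. -/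
theorem eventually_abs_sub_le (u : Trajectory) {s : ℝ} (hs : 0 ≤ s) {ε : ℝ} (hε : 0 < ε) :
    ∀ᶠ t in 𝓝[Ici 0] s, ∀ x ∈ Icc (0 : ℝ) 1, |u x t - u x s| ≤ ε := by
  have h1 := ENNReal.tendsto_toReal ENNReal.zero_ne_top |>.comp (u.tendsto_val s hs)
  have h2 := ENNReal.tendsto_toReal ENNReal.zero_ne_top |>.comp (u.tendsto_dx s hs)
  have h3 := (h1.add h2).eventually_lt_const (u := ε) (by simpa using hε)
  filter_upwards [h3, self_mem_nhdsWithin] with t ht ht0 x hx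
  refine (abs_le_l2norm_add ((u.memLp_val ht0).sub (u.memLp_val hs))
    ((u.memLp_dx ht0).sub (u.memLp_dx hs)) ?_ x hx).trans ht.le
  intro x hx
  have hi : ∀ {t : ℝ}, 0 ≤ t → IntervalIntegrable (fun y => u.dx y t) volume 0 x := fun {t} ht =>
    ((u.continuousOn_dx t ht).mono (Icc_subset_Icc_right hx.2)).intervalIntegrable_of_Icc hx.1
  simp only [Pi.sub_apply]
  rw [intervalIntegral.integral_sub (hi ht0) (hi hs), u.val_eq ht0 x hx, u.val_eq hs x hx]
  ring

/-- Local bounds in time are joined by compactness of [0,T]. Without this the suprema defining the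
weighted norms could be meaningless. -/
theorem exists_bound (u : Trajectory) (T : ℝ) :
    ∃ B, ∀ t ∈ Icc 0 T, ∀ x ∈ Icc (0 : ℝ) 1, |u x t| ≤ B := by
  refine isCompact_Icc.induction_on (p := fun A => ∃ B, ∀ t ∈ A, ∀ x ∈ Icc (0 : ℝ) 1, |u x t| ≤ B)
    ⟨0, by simp⟩ ?_ ?_ ?_
  · rintro A A' h ⟨B, hB⟩
    exact ⟨B, fun t ht => hB t (h ht)⟩
  · rintro A A' ⟨B, hB⟩ ⟨B', hB'⟩
    refine ⟨max B B', fun t ht x hx => ?_⟩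
    rcases ht with ht | ht
    · exact (hB t ht x hx).trans (le_max_left _ _)
    · exact (hB' t ht x hx).trans (le_max_right _ _)
  · intro s hs
    obtain ⟨C, hC⟩ := isCompact_Icc.exists_bound_of_continuousOn (u.continuousOn_val s hs.1)
    refine ⟨_, nhdsWithin_mono s Icc_subset_Ici_self (u.eventually_abs_sub_le hs.1 one_pos),
      C + 1, fun t ht x hx => ?_⟩
    have := hC x hx
    have h2 : |u x t - u x s| ≤ 1 := ht x hx
    rw [Real.norm_eq_abs] at this
    linarith [abs_sub_abs_le_abs_sub (u x t) (u x s)]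

end Trajectory

open scoped Classical in
/-- The class in `L²(0,1)` of a square integrable function (zero for other functions). -/
def toL2 (w : ℝ → ℝ) : Lp ℝ 2 unitMeasure :=
  if h : MemLp w 2 unitMeasure then h.toLp w else 0

theorem coeFn_toL2 {w : ℝ → ℝ} (h : MemLp w 2 unitMeasure) : toL2 w =ᵐ[unitMeasure] w := by
  rw [toL2, dif_pos h]
  exact h.coeFn_toLp

theorem norm_eq_toReal_l2norm {v : Lp ℝ 2 unitMeasure} {w : ℝ → ℝ} (h : v =ᵐ[unitMeasure] w) :
    ‖v‖ = (l2norm w).toReal := by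
  rw [Lp.norm_def, eLpNorm_congr_ae h]
  rfl

namespace Trajectory

theorem continuousOn_toL2 (u : Trajectory) :
    ContinuousOn (fun t => toL2 (fun x => u x t)) (Ici 0) := by
  intro s hs
  refine tendsto_iff_norm_sub_tendsto_zero.2 ?_
  refine ((ENNReal.tendsto_toReal ENNReal.zero_ne_top).comp (u.tendsto_val s hs)).congr' ?_
  filter_upwards [self_mem_nhdsWithin] with t ht
  refine (norm_eq_toReal_l2norm ?_).symm
  filter_upwards [Lp.coeFn_sub (toL2 (fun x => u x t)) (toL2 (fun x => u x s)),
    coeFn_toL2 (u.memLp_val ht), coeFn_toL2 (u.memLp_val hs)] with x h1 h2 h3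
  rw [h1, Pi.sub_apply, h2, h3]

theorem hasDerivAt_toL2 (u : Trajectory) {t : ℝ} (ht : 0 < t) :
    HasDerivAt (fun t => toL2 (fun x => u x t)) (toL2 (fun x => u.dt x t)) t := by
  rw [hasDerivAt_iff_tendsto_slope_zero]
  refine tendsto_iff_norm_sub_tendsto_zero.2 ?_
  refine ((ENNReal.tendsto_toReal ENNReal.zero_ne_top).comp (u.hasDeriv_val t ht)).congr' ?_
  filter_upwards [eventually_add_pos ht] with h hh
  refine (norm_eq_toReal_l2norm ?_).symm
  filter_upwards [Lp.coeFn_sub (h⁻¹ • (toL2 (fun x => u x (t + h)) - toL2 (fun x => u x t)))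
      (toL2 (fun x => u.dt x t)),
    Lp.coeFn_smul h⁻¹ (toL2 (fun x => u x (t + h)) - toL2 (fun x => u x t)),
    Lp.coeFn_sub (toL2 (fun x => u x (t + h))) (toL2 (fun x => u x t)),
    coeFn_toL2 (u.memLp_val hh), coeFn_toL2 (u.memLp_val ht.le),
    coeFn_toL2 (u.memLp_dt t ht)] with x h1 h2 h3 h4 h5 h6
  rw [h1, Pi.sub_apply, h2, Pi.smul_apply, h3, Pi.sub_apply, h4, h5, h6, smul_eq_mul]

/-! ### The weighted maximum principle -/

theorem continuousOn_posPart (z : Trajectory) (m : ℝ) {t : ℝ} (ht : 0 ≤ t) :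
    ContinuousOn (fun x => max (z x t - m) 0) (Icc 0 1) :=
  (continuous_id.max continuous_const).comp_continuousOn
    ((z.continuousOn_val t ht).sub continuousOn_const)

/-- The spatial energy estimate for the truncated equation. -/
theorem integral_posPart_mul_nonpos {α lam σ l m : ℝ} (hα : 0 ≤ α) (hlam : 0 ≤ lam) (hl : 0 ≤ l)
    {f : ℝ → ℝ → ℝ} {z : Trajectory} (hz : SolvesHeat α lam f z) {t : ℝ} (ht : 0 < t)
    (hf : ∀ x ∈ Ioo (0 : ℝ) 1, f x t ≤ (lam - σ) * m)
    (hleft : z 0 t ≤ m ∨ z.dx 0 t = 0) (hright : z.dx 1 t + l * z 1 t ≤ l * m) :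
    ∫ x, max (z x t - m) 0 * (z.dt x t + σ * m) ∂unitMeasure ≤ 0 := by
  have mc : MemLp (fun _ : ℝ => m) 2 unitMeasure := memLp_const m
  have mp : MemLp (fun x => max (z x t - m) 0) 2 unitMeasure :=
    memLp_of_continuousOn (z.continuousOn_posPart m ht.le) 2
  have i1 : Integrable (fun x => max (z x t - m) 0 * (z.dt x t + σ * m)) unitMeasure :=
    mp.integrable_mul ((z.memLp_dt t ht).add (mc.const_mul σ))
  have i2 : Integrable (fun x => max (z x t - m) 0 * z.dxx x t) unitMeasure :=
    mp.integrable_mul (z.memLp_dxx t ht.le)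
  have h1 : ∫ x, max (z x t - m) 0 * (z.dt x t + σ * m) ∂unitMeasure
      ≤ ∫ x, α * (max (z x t - m) 0 * z.dxx x t) ∂unitMeasure := by
    refine integral_mono_ae i1 (i2.const_mul α) ?_
    filter_upwards [hz t ht, ae_unitMeasure_iff.2 (.of_forall hf)] with x hx hfx
    rw [hx]
    have hp : 0 ≤ max (z x t - m) 0 := le_max_right _ _
    have hpp : max (z x t - m) 0 * (z x t - m) = max (z x t - m) 0 * max (z x t - m) 0 := by
      rcases max_cases (z x t - m) 0 with ⟨h, _⟩ | ⟨h, _⟩ <;> rw [h]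
      simp
    -- By the equation, z_t + σm = α z_xx - λ(z - m) + (f - (λ - σ)m); after multiplication by (z -
    -- m)⁺ the last two terms are nonpositive.
    nlinarith [mul_nonneg hp (sub_nonneg.2 hfx), mul_nonneg hlam (mul_self_nonneg
      (max (z x t - m) 0))]
  have h2 := integral_max_zero_mul_le (w := fun x => z x t - m) (z.continuousOn_dx t ht.le)
    (fun x hx => by simp only [z.val_eq ht.le x hx]; ring)
    ((z.memLp_dxx t ht.le).integrable one_le_two) (z.dx_eq ht.le)
  have h3 : max (z 0 t - m) 0 * z.dx 0 t = 0 := by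
    rcases hleft with h | h
    · rw [max_eq_right (by linarith), zero_mul]
    · rw [h, mul_zero]
  -- Where z(1,t) exceeds m, the Robin inequality forces z_x(1,t) ≤ -l(z(1,t) - m) ≤ 0.
  have h4 : max (z 1 t - m) 0 * z.dx 1 t ≤ 0 := by
    rcases max_cases (z 1 t - m) 0 with ⟨h, h'⟩ | ⟨h, h'⟩ <;> rw [h]
    · nlinarith [mul_nonneg hl h']
    · simp
  rw [integral_const_mul] at h1
  refine h1.trans (mul_nonpos_of_nonneg_of_nonpos hα (h2.trans ?_))
  linarith

/-- The upper half of the maximum principle for the heat equation with Dirichlet or homogeneous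
Neumann condition on the left and Robin condition on the right. -/
theorem le_mul_exp {α lam σ l K T : ℝ} (hα : 0 ≤ α) (hlam : 0 ≤ lam) (hl : 0 ≤ l)
    {f : ℝ → ℝ → ℝ} {z : Trajectory} (hz : SolvesHeat α lam f z)
    (h0 : ∀ x ∈ Icc (0 : ℝ) 1, z x 0 ≤ K)
    (hf : ∀ t ∈ Ioc 0 T, ∀ x ∈ Ioo (0 : ℝ) 1, f x t ≤ (lam - σ) * (K * Real.exp (-σ * t)))
    (hleft : ∀ t ∈ Ioc 0 T, z 0 t ≤ K * Real.exp (-σ * t) ∨ z.dx 0 t = 0)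
    (hright : ∀ t ∈ Ioc 0 T, z.dx 1 t + l * z 1 t ≤ l * (K * Real.exp (-σ * t))) :
    ∀ t ∈ Icc 0 T, ∀ x ∈ Icc (0 : ℝ) 1, z x t ≤ K * Real.exp (-σ * t) := by
  -- The barrier is constant in space and satisfies m' + λm = (λ - σ)m, which dominates f.
  set m : ℝ → ℝ := fun t => K * Real.exp (-σ * t) with hm
  have hmd : ∀ t, HasDerivAt m (-(σ * m t)) t := by
    intro t
    have := (((hasDerivAt_id t).const_mul (-σ)).exp).const_mul K
    refine this.congr_deriv ?_
    simp only [hm, id]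
    ring
  have hmc : Continuous m := continuous_iff_continuousAt.2 fun t => (hmd t).continuousAt
  set e : Lp ℝ 2 unitMeasure := toL2 fun _ => 1 with he
  have hee : e =ᵐ[unitMeasure] fun _ => 1 := coeFn_toL2 (memLp_const 1)
  set W : ℝ → Lp ℝ 2 unitMeasure := fun t => toL2 (fun x => z x t) - m t • e with hW
  have hWe : ∀ t, 0 ≤ t → W t =ᵐ[unitMeasure] fun x => z x t - m t := by
    intro t ht
    filter_upwards [Lp.coeFn_sub (toL2 (fun x => z x t)) (m t • e), Lp.coeFn_smul (m t) e,
      coeFn_toL2 (z.memLp_val ht), hee] with x h1 h2 h3 h4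
    rw [h1, Pi.sub_apply, h2, Pi.smul_apply, h3, h4, smul_eq_mul, mul_one]
  have hWp : ∀ t, 0 ≤ t → Lp.posPart (W t) =ᵐ[unitMeasure] fun x => max (z x t - m t) 0 := by
    intro t ht
    filter_upwards [Lp.coeFn_posPart (W t), hWe t ht] with x h1 h2
    rw [h1, h2]
  have hWd : ∀ t, 0 < t → HasDerivAt W (toL2 (fun x => z.dt x t) - (-(σ * m t)) • e) t :=
    fun t ht => (z.hasDerivAt_toL2 ht).sub ((hmd t).smul_const e)
  have hφd : ∀ t, 0 < t → HasDerivAt (fun t => ‖Lp.posPart (W t)‖ ^ 2)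
      (2 * ∫ x, max (z x t - m t) 0 * (z.dt x t + σ * m t) ∂unitMeasure) t := by
    intro t ht
    refine ((hasFDerivAt_norm_posPart_sq (W t)).comp_hasDerivAt t (hWd t ht)).congr_deriv ?_
    rw [smul_apply, innerSL_apply_apply, L2.inner_def, smul_eq_mul]
    congr 1
    refine integral_congr_ae ?_
    filter_upwards [hWp t ht.le, hee, coeFn_toL2 (z.memLp_dt t ht),
      Lp.coeFn_sub (toL2 (fun x => z.dt x t)) ((-(σ * m t)) • e),
      Lp.coeFn_smul (-(σ * m t)) e] with x h1 h2 h3 h4 h5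
    rw [h1, h4, Pi.sub_apply, h5, Pi.smul_apply, h2, h3]
    simp only [RCLike.inner_apply, conj_trivial, smul_eq_mul]
    ring
  have hφc : ContinuousOn (fun t => ‖Lp.posPart (W t)‖ ^ 2) (Icc 0 T) := by
    have h1 : ContinuousOn W (Icc 0 T) :=
      (z.continuousOn_toL2.mono Icc_subset_Ici_self).sub
        (hmc.smul continuous_const).continuousOn
    exact ((Lp.continuous_posPart.comp_continuousOn h1).norm).pow 2
  -- Time derivatives exist only for t > 0, so the initial time is reached through continuity of the
  -- energy on the closed interval.
  have hanti : AntitoneOn (fun t => ‖Lp.posPart (W t)‖ ^ 2) (Icc 0 T) := by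
    refine antitoneOn_of_deriv_nonpos (convex_Icc 0 T) hφc ?_ ?_
    · rw [interior_Icc]
      exact fun t ht => (hφd t ht.1).differentiableAt.differentiableWithinAt
    · rw [interior_Icc]
      intro t ht
      have ht' : t ∈ Ioc 0 T := ⟨ht.1, ht.2.le⟩
      rw [(hφd t ht.1).deriv]
      have := integral_posPart_mul_nonpos hα hlam hl hz ht.1 (hf t ht') (hleft t ht')
        (hright t ht')
      linarith
  intro t ht x hx
  have hzero : Lp.posPart (W 0) = 0 := by
    rw [Lp.eq_zero_iff_ae_eq_zero]
    filter_upwards [hWp 0 le_rfl, ae_unitMeasure_iff.2 (.of_forall fun x hx =>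
      h0 x (Ioo_subset_Icc_self hx))] with x h1 h2
    rw [h1, Pi.zero_apply]
    exact max_eq_right (by simpa [hm] using h2)
  have hle := hanti (left_mem_Icc.2 (ht.1.trans ht.2)) ht ht.1
  simp only [hzero, norm_zero] at hle
  have hWt : Lp.posPart (W t) = 0 := by
    rw [← norm_eq_zero]
    nlinarith [norm_nonneg (Lp.posPart (W t))]
  have hae : (fun x => max (z x t - m t) 0) =ᵐ[unitMeasure] fun _ => 0 :=
    (hWp t ht.1).symm.trans (Lp.eq_zero_iff_ae_eq_zero.1 hWt)
  have := eqOn_of_ae_eq (z.continuousOn_posPart (m t) ht.1) continuousOn_const hae hx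
  have h2 := le_max_left (z x t - m t) 0
  simp only at this
  linarith

/-- The weighted maximum principle for the heat equation with Dirichlet or homogeneous
Neumann condition on the left and Robin condition on the right. -/
theorem exp_mul_abs_le {α lam σ l K T : ℝ} (hα : 0 ≤ α) (hlam : 0 ≤ lam) (hl : 0 ≤ l)
    {f : ℝ → ℝ → ℝ} {z : Trajectory} (hz : SolvesHeat α lam f z)
    (h0 : ∀ x ∈ Icc (0 : ℝ) 1, |z x 0| ≤ K)
    (hf : ∀ t ∈ Ioc 0 T, ∀ x ∈ Ioo (0 : ℝ) 1, Real.exp (σ * t) * |f x t| ≤ (lam - σ) * K)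
    (hleft : (∀ t ∈ Ioc 0 T, Real.exp (σ * t) * |z 0 t| ≤ K) ∨ ∀ t ∈ Ioc 0 T, z.dx 0 t = 0)
    (hright : ∀ t ∈ Ioc 0 T, Real.exp (σ * t) * |z.dx 1 t + l * z 1 t| ≤ l * K) :
    ∀ t ∈ Icc 0 T, ∀ x ∈ Icc (0 : ℝ) 1, Real.exp (σ * t) * |z x t| ≤ K := by
  have hexp : ∀ {t a b : ℝ}, Real.exp (σ * t) * a ≤ b ↔ a ≤ b * Real.exp (-σ * t) := by
    intro t a b
    rw [neg_mul, Real.exp_neg, ← div_eq_mul_inv, le_div_iff₀ (Real.exp_pos _), mul_comm]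
  simp only [hexp, mul_assoc, abs_le] at hf hleft hright ⊢
  simp only [abs_le] at h0
  have up := le_mul_exp (σ := σ) (T := T) hα hlam hl hz (fun x hx => (h0 x hx).2)
    (fun t ht x hx => (hf t ht x hx).2)
    (fun t ht => hleft.imp (fun h => (h t ht).2) fun h => h t ht) (fun t ht => (hright t ht).2)
  -- The lower bound is the upper bound for -z, written as the combination with coefficients -1 and
  -- 0.
  have lo := le_mul_exp (σ := σ) (T := T) hα hlam hl (hz.lincomb (-1) 0 hz) (K := K)
    (fun x hx => by simpa using neg_le.1 (h0 x hx).1)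
    (fun t ht x hx => by simpa using neg_le.1 (hf t ht x hx).1)
    (fun t ht => hleft.imp (fun h => by simpa using neg_le.1 (h t ht).1)
      fun h => by simpa using h t ht)
    (fun t ht => by
      have := neg_le.1 (hright t ht).1
      simp only [lincomb_val, lincomb_dx]
      linarith)
  intro t ht x hx
  have h1 := lo t ht x hx
  simp only [lincomb_val] at h1
  exact ⟨by linarith, up t ht x hx⟩

end Trajectory

/-! ### Cyclic indices and iterated inequalities -/

theorem cyc_mem {N : ℕ} (hN : 0 < N) (m : ℤ) : cyc N m ∈ Icc 1 N := by
  have h1 := Int.emod_nonneg (m - 1) (b := N) (by omega)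
  have h2 := Int.emod_lt_of_pos (m - 1) (b := N) (by omega)
  simp only [cyc, mem_Icc]
  omega

theorem cyc_cast {N : ℕ} (hN : 0 < N) (m : ℤ) : (cyc N m : ℤ) = (m - 1) % N + 1 := by
  have h1 := Int.emod_nonneg (m - 1) (b := N) (by omega)
  simp only [cyc]
  omega

theorem cyc_of_mem {N i : ℕ} (hi : i ∈ Icc 1 N) : cyc N i = i := by
  have h : ((i : ℤ) - 1) % N = i - 1 := Int.emod_eq_of_lt (by have := hi.1; omega)
    (by have := hi.2; omega)
  have := hi.1
  simp only [cyc, h]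
  omega

theorem cyc_congr {N : ℕ} {m n : ℤ} (h : m % N = n % N) : cyc N m = cyc N n := by
  simp only [cyc, Int.sub_emod m, Int.sub_emod n, h]

theorem cyc_sub_self (N : ℕ) (m : ℤ) : cyc N (m - N) = cyc N m :=
  cyc_congr (by simp)

theorem cyc_cyc_sub {N : ℕ} (hN : 0 < N) (m c : ℤ) : cyc N ((cyc N m : ℤ) - c) = cyc N (m - c) := by
  refine cyc_congr ?_
  rw [cyc_cast hN, show (m - 1) % (N : ℤ) + 1 - c = (m - 1) % (N : ℤ) + (1 - c) by ring,
    Int.emod_add_emod]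
  congr 1
  ring

theorem cyc_injOn {N : ℕ} (hN : 0 < N) (i : ℤ) :
    InjOn (fun r : ℕ => cyc N (i - r)) (Finset.range N : Set ℕ) := by
  intro r hr s hs h
  have h1 : (cyc N (i - r) : ℤ) = cyc N (i - s) := congrArg _ h
  rw [cyc_cast hN, cyc_cast hN, add_left_inj] at h1
  have h3 := Int.ModEq.dvd h1
  simp only [Finset.coe_range, mem_Iio] at hr hs
  obtain ⟨c, hc⟩ := h3
  have : c = 0 := by
    by_contra hne
    rcases lt_or_gt_of_ne hne with h | h <;> nlinarith
  subst this
  omega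

/-- Iteration of a first order recursive inequality. -/
theorem le_sum_prod_of_rec {y e a : ℤ → ℝ} (ha : ∀ m, 0 ≤ a m)
    (h : ∀ m, y m ≤ e m + a m * y (m - 1)) (i : ℤ) (n : ℕ) :
    y i ≤ ∑ m ∈ Finset.range n, (∏ r ∈ Finset.range m, a (i - r)) * e (i - m)
      + (∏ r ∈ Finset.range n, a (i - r)) * y (i - n) := by
  induction n with
  | zero => simp
  | succ n ih =>
    rw [Finset.sum_range_succ, Finset.prod_range_succ]
    have hp : 0 ≤ ∏ r ∈ Finset.range n, a (i - r) := Finset.prod_nonneg fun r _ => ha _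
    have h1 := mul_le_mul_of_nonneg_left (h (i - n)) hp
    have h2 : i - ((n + 1 : ℕ) : ℤ) = i - n - 1 := by push_cast; ring
    rw [h2]
    linarith

/-- For i < N the two sides agree. For i = N the right side has the surplus term m = N, which is why
only an inequality holds. -/
theorem sum_range_le_sum_split {N i : ℕ} (hi : i ∈ Icc 1 N) {F : ℕ → ℝ} (hF : ∀ m, 0 ≤ F m) :
    ∑ m ∈ Finset.range N, F m ≤ F 0 + ∑ m ∈ Finset.Icc 1 i, F m
      + ∑ m ∈ Finset.Icc (i + 1) (N - 1), F m := by
  have h1 := hi.1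
  have h2 := hi.2
  have e1 : F 0 + ∑ m ∈ Finset.Icc 1 i, F m = ∑ m ∈ Finset.range (i + 1), F m := by
    rw [Finset.range_eq_Ico, Finset.sum_eq_sum_Ico_succ_bot (by omega)]
    rfl
  have e2 : Finset.Icc (i + 1) (N - 1) = Finset.Ico (i + 1) N := by
    ext m
    simp only [Finset.mem_Icc, Finset.mem_Ico]
    omega
  rw [e1, e2]
  rcases h2.lt_or_eq with h | rfl
  · rw [Finset.sum_range_add_sum_Ico F h]
  · rw [Finset.Ico_eq_empty (by omega), Finset.sum_empty, add_zero, Finset.sum_range_succ]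
    linarith [hF i]

/-! ### Products of gains and the cyclic systems of inequalities -/

namespace Network

variable (S : Network)

theorem N_pos : 0 < S.N := by have := S.two_le_N; omega

theorem kc_pos (m : ℤ) : 0 < S.kc m := (S.k_mem _ (cyc_mem S.N_pos m)).1

theorem kc_of_mem {i : ℕ} (hi : i ∈ Icc 1 S.N) : S.kc i = S.k i := by
  rw [kc, cyc_of_mem hi]

theorem kc_congr {m n : ℤ} (h : m % S.N = n % S.N) : S.kc m = S.kc n := by
  rw [kc, kc, cyc_congr h]

theorem loopGain_lt_one : S.loopGain < 1 := by
  rw [loopGain, div_lt_one (pow_pos S.l_pos _)]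
  have h1 : 1 ∈ Finset.Icc 1 S.N := Finset.mem_Icc.2 ⟨le_rfl, S.N_pos⟩
  have := Finset.prod_lt_prod (s := Finset.Icc 1 S.N) (f := S.k) (g := fun _ => S.l)
    (fun i hi => (S.k_mem i (by simpa using hi)).1)
    (fun i hi => (S.k_mem i (by simpa using hi)).2.le) ⟨1, h1, (S.k_mem 1 (by simpa using h1)).2⟩
  simpa using this

/-- N consecutive cyclic indices visit every agent exactly once, so the product does not depend on
the starting point. -/
theorem prod_kc_eq (i : ℤ) :
    ∏ r ∈ Finset.range S.N, S.kc (i - r) = ∏ i ∈ Finset.Icc 1 S.N, S.k i := by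
  have himg : (Finset.range S.N).image (fun r : ℕ => cyc S.N (i - r)) = Finset.Icc 1 S.N := by
    refine Finset.eq_of_subset_of_card_le (fun m hm => ?_) ?_
    · obtain ⟨r, _, rfl⟩ := Finset.mem_image.1 hm
      exact Finset.mem_Icc.2 (cyc_mem S.N_pos _)
    · rw [Finset.card_image_of_injOn (cyc_injOn S.N_pos i)]
      simp
  rw [← himg, Finset.prod_image (cyc_injOn S.N_pos i)]
  rfl

theorem prod_kc_div (i : ℤ) (m : ℕ) :
    ∏ r ∈ Finset.range m, S.kc (i - r) / S.l = (∏ r ∈ Finset.range m, S.kc (i - r)) / S.l ^ m := by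
  rw [Finset.prod_div_distrib, Finset.prod_const, Finset.card_range]

/-- After i factors the index passes from 1 to 0, which is read as N; the remaining factors start
there. -/
theorem prod_kc_split {i m : ℕ} (h : i ≤ m) :
    ∏ r ∈ Finset.range m, S.kc ((i : ℤ) - r) =
      (∏ r ∈ Finset.range i, S.kc ((i : ℤ) - r)) *
        ∏ s ∈ Finset.range (m - i), S.kc ((S.N : ℤ) - s) := by
  obtain ⟨n, rfl⟩ := Nat.exists_eq_add_of_le h
  rw [Finset.prod_range_add, Nat.add_sub_cancel_left]
  congr 1
  refine Finset.prod_congr rfl fun s _ => S.kc_congr ?_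
  rw [show (i : ℤ) - ((i + s : ℕ) : ℤ) = -s by push_cast; ring, sub_eq_neg_add,
    Int.add_emod_right]

theorem prod_kc_nonneg (i : ℤ) (m : ℕ) : 0 ≤ ∏ r ∈ Finset.range m, S.kc (i - r) :=
  Finset.prod_nonneg fun _ _ => (S.kc_pos _).le

theorem sum_prod_le_Mcal {i : ℕ} (hi : i ∈ Icc 1 S.N) :
    ∑ m ∈ Finset.range S.N, (∏ r ∈ Finset.range m, S.kc ((i : ℤ) - r)) / S.l ^ m ≤ S.Mcal i := by
  refine (sum_range_le_sum_split hi fun m =>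
    div_nonneg (S.prod_kc_nonneg i m) (pow_pos S.l_pos m).le).trans_eq ?_
  rw [Mcal]
  congr 1
  · simp
  · refine Finset.sum_congr rfl fun m hm => ?_
    rw [S.prod_kc_split (by have := (Finset.mem_Icc.1 hm).1; omega)]

theorem prod_range_kc_eq_prod_Icc (n : ℕ) :
    ∏ s ∈ Finset.range n, S.kc ((S.N : ℤ) - s) =
      ∏ s ∈ Finset.Icc 1 n, S.kc ((S.N : ℤ) + 1 - s) := by
  induction n with
  | zero => simp
  | succ n ih =>
    rw [Finset.prod_range_succ, Finset.prod_Icc_succ_top (by omega), ih]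
    push_cast
    rw [add_sub_add_right_eq_sub]

theorem sum_prod_le_Hcal {i j : ℕ} (hi : i ∈ Icc 1 S.N) (hj : j ∈ Icc 1 S.N) :
    ∑ m ∈ Finset.range S.N, ((∏ r ∈ Finset.range m, S.kc ((j : ℤ) - r)) *
      |S.kc ((i : ℤ) - m) - S.kc ((j : ℤ) - m)|) / S.l ^ (m + 1) ≤ S.Hcal i j := by
  refine (sum_range_le_sum_split hj fun m => div_nonneg
    (mul_nonneg (S.prod_kc_nonneg j m) (abs_nonneg _)) (pow_pos S.l_pos _).le).trans_eq ?_
  rw [Hcal]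
  congr 1
  · simp [S.kc_of_mem hi, S.kc_of_mem hj]
  · refine Finset.sum_congr rfl fun m hm => ?_
    rw [S.prod_kc_split (by have := (Finset.mem_Icc.1 hm).1; omega), Kcal,
      S.kc_congr (Int.add_emod_right ((i : ℤ) - m) S.N),
      S.kc_congr (Int.add_emod_right ((j : ℤ) - m) S.N),
      S.prod_range_kc_eq_prod_Icc]

/-- Solution of the cyclic system of inequalities for a synchronized family of pairs. -/
theorem le_of_cyclic_pairs {z : ℕ → ℕ → ℝ} {E P : ℝ} (hE : 0 ≤ E) (hP : 0 ≤ P)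
    (h : ∀ i ∈ Icc 1 S.N, ∀ j ∈ Icc 1 S.N, z i j ≤ E + |S.k i - S.k j| / S.l * P
      + S.k j / S.l * z (cyc S.N ((i : ℤ) - 1)) (cyc S.N ((j : ℤ) - 1)))
    {i j : ℕ} (hi : i ∈ Icc 1 S.N) (hj : j ∈ Icc 1 S.N) :
    z i j ≤ S.Ccal j * E + S.Hcal i j / (1 - S.loopGain) * P := by
  -- With i - j fixed, the pairs form a sequence indexed by one integer m; starting at m = j, N
  -- steps lead back to the pair (i,j).
  have h1 := le_sum_prod_of_rec (y := fun m => z (cyc S.N (i - j + m)) (cyc S.N m))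
    (e := fun m => E + |S.kc (i - j + m) - S.kc m| / S.l * P) (a := fun m => S.kc m / S.l)
    (fun m => (div_pos (S.kc_pos m) S.l_pos).le) (fun m => by
      have := h _ (cyc_mem S.N_pos (i - j + m)) _ (cyc_mem S.N_pos m)
      rw [cyc_cyc_sub S.N_pos, cyc_cyc_sub S.N_pos, add_sub_assoc] at this
      exact this) j S.N
  simp only [sub_add_cancel, cyc_of_mem hi, cyc_of_mem hj, cyc_sub_self, S.prod_kc_div,
    S.prod_kc_eq] at h1
  have h2 : ∀ m : ℕ, (i : ℤ) - j + (j - m) = i - m := fun m => by ring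
  simp only [h2, cyc_sub_self, cyc_of_mem hi] at h1
  have hM := mul_le_mul_of_nonneg_right (S.sum_prod_le_Mcal hj) hE
  have hH := mul_le_mul_of_nonneg_right (S.sum_prod_le_Hcal hi hj) hP
  rw [Finset.sum_mul] at hM hH
  have hs : ∑ m ∈ Finset.range S.N, (∏ r ∈ Finset.range m, S.kc ((j : ℤ) - r)) / S.l ^ m *
      (E + |S.kc ((i : ℤ) - m) - S.kc ((j : ℤ) - m)| / S.l * P) ≤
      S.Mcal j * E + S.Hcal i j * P := by
    refine le_trans (le_of_eq ?_) (add_le_add hM hH)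
    rw [← Finset.sum_add_distrib]
    refine Finset.sum_congr rfl fun m _ => ?_
    have := S.l_pos.ne'
    field_simp
    ring
  have hg : 0 < 1 - S.loopGain := sub_pos.2 S.loopGain_lt_one
  -- The term 𝒩 z_{ij} left over after the full turn is moved to the left.
  have h4 : z i j * (1 - S.loopGain) ≤ S.Mcal j * E + S.Hcal i j * P := by
    have : (∏ i ∈ Finset.Icc 1 S.N, S.k i) / S.l ^ S.N = S.loopGain := rfl
    rw [this] at h1
    linarith
  rw [Ccal, div_mul_eq_mul_div, div_mul_eq_mul_div, ← add_div, le_div_iff₀ hg]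
  exact h4


/-- The solved bound is inserted only for the predecessor pair in the original recursion; this
yields the constants 𝒞̃ and ℋ̃. -/
theorem le_Htilde_of_cyclic_pairs {z : ℕ → ℕ → ℝ} {E P : ℝ} (hE : 0 ≤ E) (hP : 0 ≤ P)
    (h : ∀ i ∈ Icc 1 S.N, ∀ j ∈ Icc 1 S.N, z i j ≤ E + |S.k i - S.k j| / S.l * P
      + S.k j / S.l * z (cyc S.N ((i : ℤ) - 1)) (cyc S.N ((j : ℤ) - 1)))
    {i j : ℕ} (hi : i ∈ Icc 1 S.N) (hj : j ∈ Icc 1 S.N) :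
    z i j ≤ S.Ctilde j * E + S.Htilde i j * P := by
  have h1 := S.le_of_cyclic_pairs hE hP h (cyc_mem S.N_pos ((i : ℤ) - 1))
    (cyc_mem S.N_pos ((j : ℤ) - 1))
  have h2 := mul_le_mul_of_nonneg_left h1 (div_pos (S.k_mem j hj).1 S.l_pos).le
  refine ((h i hi j hj).trans (add_le_add_right h2 _)).trans_eq ?_
  rw [Ctilde, Htilde]
  have := S.l_pos.ne'
  have := (sub_pos.2 S.loopGain_lt_one).ne'
  field_simp
  ring

/-- Solution of the cyclic system of inequalities. -/
theorem le_Ctilde_of_cyclic {y : ℕ → ℝ} {E : ℝ} (hE : 0 ≤ E)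
    (h : ∀ i ∈ Icc 1 S.N, y i ≤ E + S.k i / S.l * y (cyc S.N ((i : ℤ) - 1)))
    {i : ℕ} (hi : i ∈ Icc 1 S.N) : y i ≤ S.Ctilde i * E := by
  -- A family that ignores its first index, with P = 0, reduces pairs to single agents.
  have := S.le_Htilde_of_cyclic_pairs (z := fun _ j => y j) hE le_rfl
    (fun i _ j hj => by simpa using h j hj) hi hi
  simpa using this

/-- The zero sequence satisfies the recursion with E = 1, so the resulting bound is the claim. -/
theorem Ctilde_nonneg {i : ℕ} (hi : i ∈ Icc 1 S.N) : 0 ≤ S.Ctilde i := by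
  simpa using S.le_Ctilde_of_cyclic (y := fun _ => 0) zero_le_one (by simp) hi

end Network

/-! ### Maximum norms and maxima over agents -/

theorem abs_le_maxNorm_of_bound {X : Type*} {A : Set X} {h : X → ℝ} {B : ℝ}
    (hB : ∀ x ∈ A, |h x| ≤ B) {x : X} (hx : x ∈ A) : |h x| ≤ maxNorm A h := by
  refine le_csSup ⟨B, ?_⟩ (mem_image_of_mem _ hx)
  rintro _ ⟨y, hy, rfl⟩
  exact hB y hy

theorem abs_le_maxNorm {X : Type*} [TopologicalSpace X] {A : Set X} (hA : IsCompact A)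
    {h : X → ℝ} (hh : ContinuousOn h A) {x : X} (hx : x ∈ A) : |h x| ≤ maxNorm A h := by
  obtain ⟨B, hB⟩ := hA.exists_bound_of_continuousOn hh
  exact abs_le_maxNorm_of_bound hB hx

theorem maxNorm_le {X : Type*} {A : Set X} {h : X → ℝ} {B : ℝ} (hB0 : 0 ≤ B)
    (hB : ∀ x ∈ A, |h x| ≤ B) : maxNorm A h ≤ B := by
  refine Real.sSup_le ?_ hB0
  rintro _ ⟨y, hy, rfl⟩
  exact hB y hy

theorem maxNorm_nonneg {X : Type*} (A : Set X) (h : X → ℝ) : 0 ≤ maxNorm A h := by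
  refine Real.sSup_nonneg ?_
  rintro _ ⟨y, hy, rfl⟩
  exact abs_nonneg _

theorem le_maxAgents {N i : ℕ} (hi : i ∈ Icc 1 N) (F : ℕ → ℝ) : F i ≤ maxAgents N F :=
  le_csSup ((finite_Icc 1 N).image F).bddAbove (mem_image_of_mem _ hi)

theorem maxAgents_le {N : ℕ} {F : ℕ → ℝ} {B : ℝ} (hB0 : 0 ≤ B) (hB : ∀ i ∈ Icc 1 N, F i ≤ B) :
    maxAgents N F ≤ B := by
  refine Real.sSup_le ?_ hB0
  rintro _ ⟨y, hy, rfl⟩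
  exact hB y hy

theorem maxAgents_nonneg {N : ℕ} {F : ℕ → ℝ} (hF : ∀ i ∈ Icc 1 N, 0 ≤ F i) :
    0 ≤ maxAgents N F := by
  refine Real.sSup_nonneg ?_
  rintro _ ⟨y, hy, rfl⟩
  exact hF y hy

theorem le_maxPairs {N i j : ℕ} (hi : i ∈ Icc 1 N) (hj : j ∈ Icc 1 N) (F : ℕ → ℕ → ℝ) :
    F i j ≤ maxPairs N F :=
  le_csSup (((finite_Icc 1 N).prod (finite_Icc 1 N)).image _).bddAbove
    (mem_image_of_mem (fun p : ℕ × ℕ => F p.1 p.2) (mk_mem_prod hi hj))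

theorem maxPairs_le {N : ℕ} {F : ℕ → ℕ → ℝ} {B : ℝ} (hB0 : 0 ≤ B)
    (hB : ∀ i ∈ Icc 1 N, ∀ j ∈ Icc 1 N, F i j ≤ B) : maxPairs N F ≤ B := by
  refine Real.sSup_le ?_ hB0
  rintro _ ⟨y, hy, rfl⟩
  exact hB _ hy.1 _ hy.2

theorem maxPairs_nonneg {N : ℕ} {F : ℕ → ℕ → ℝ} (hF : ∀ i j, 0 ≤ F i j) :
    0 ≤ maxPairs N F := by
  refine Real.sSup_nonneg ?_
  rintro _ ⟨y, hy, rfl⟩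
  exact hF _ _

/-! ### Weighted norms and the observer–tracking cascade -/

namespace Trajectory

/-- Difference of trajectories. -/
def sub (u v : Trajectory) : Trajectory := lincomb 1 (-1) u v

@[simp] theorem sub_val (u v : Trajectory) (x t : ℝ) : u.sub v x t = u x t - v x t := by
  simp [sub, sub_eq_add_neg]

@[simp] theorem sub_dx (u v : Trajectory) (x t : ℝ) :
    (u.sub v).dx x t = u.dx x t - v.dx x t := by
  simp [sub, sub_eq_add_neg]

end Trajectory

theorem SolvesHeat.sub {α lam : ℝ} {f g : ℝ → ℝ → ℝ} {u v : Trajectory}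
    (hu : SolvesHeat α lam f u) (hv : SolvesHeat α lam g v) :
    SolvesHeat α lam (fun x t => f x t - g x t) (u.sub v) := by
  have := hu.lincomb 1 (-1) hv
  simpa only [one_mul, neg_mul, ← sub_eq_add_neg, Trajectory.sub] using this

namespace Trajectory

/-- The exponentially weighted maximum norm on `[0,1] × [0,T]`. -/
def weightedNorm (σ T : ℝ) (z : Trajectory) : ℝ :=
  maxNorm (Icc (0 : ℝ) 1 ×ˢ Icc (0 : ℝ) T) (fun p => Real.exp (σ * p.2) * z p.1 p.2)

theorem weightedNorm_nonneg (σ T : ℝ) (z : Trajectory) : 0 ≤ z.weightedNorm σ T :=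
  maxNorm_nonneg _ _

theorem exp_mul_abs_le_weightedNorm {σ T : ℝ} (hσ : 0 ≤ σ) (z : Trajectory) {x t : ℝ}
    (hx : x ∈ Icc (0 : ℝ) 1) (ht : t ∈ Icc 0 T) :
    Real.exp (σ * t) * |z x t| ≤ z.weightedNorm σ T := by
  obtain ⟨B, hB⟩ := z.exists_bound T
  have := abs_le_maxNorm_of_bound (A := Icc (0 : ℝ) 1 ×ˢ Icc (0 : ℝ) T)
    (h := fun p => Real.exp (σ * p.2) * z p.1 p.2) (B := Real.exp (σ * T) * B)
    (fun p hp => by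
      rw [abs_mul, Real.abs_exp]
      exact mul_le_mul (Real.exp_le_exp.2 (mul_le_mul_of_nonneg_left hp.2.2 hσ))
        (hB _ hp.2 _ hp.1) (abs_nonneg _) (Real.exp_pos _).le) (mk_mem_prod hx ht)
  rwa [abs_mul, Real.abs_exp] at this

theorem weightedNorm_le {σ T C : ℝ} (hC : 0 ≤ C) {z : Trajectory}
    (h : ∀ t ∈ Icc 0 T, ∀ x ∈ Icc (0 : ℝ) 1, Real.exp (σ * t) * |z x t| ≤ C) :
    z.weightedNorm σ T ≤ C := by
  refine maxNorm_le hC fun p hp => ?_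
  rw [abs_mul, Real.abs_exp]
  exact h _ hp.2 _ hp.1

/-- The weighted bound for a tracking error `w` whose Dirichlet value is driven by an observer
error `p`. -/
theorem weightedNorm_le_of_cascade {α lam σ l T F D₀ D₁ I J Y : ℝ} (hα : 0 < α) (hσ : 0 < σ)
    (hσl : σ < lam) (hl : 0 < l) {f : ℝ → ℝ → ℝ} {w p : Trajectory}
    (hw : SolvesHeat α lam f w) (hp : SolvesHeat α lam f p)
    (hF0 : 0 ≤ F) (hD₀0 : 0 ≤ D₀) (hD₁0 : 0 ≤ D₁) (hI0 : 0 ≤ I) (hJ0 : 0 ≤ J) (hY0 : 0 ≤ Y)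
    (hF : ∀ t ∈ Ioc 0 T, ∀ x ∈ Ioo (0 : ℝ) 1, |f x t| ≤ F)
    (hI : ∀ x ∈ Icc (0 : ℝ) 1, |w x 0| ≤ I) (hJ : ∀ x ∈ Icc (0 : ℝ) 1, |p x 0| ≤ J)
    (hp0 : ∀ t ∈ Ioc 0 T, p.dx 0 t = 0) (hp1 : ∀ t ∈ Ioc 0 T, p.dx 1 t + l * p 1 t = 0)
    (hw0 : ∀ t ∈ Ioc 0 T, |w 0 t - p 0 t| ≤ D₀) {g : ℝ → ℝ}
    (hw1 : ∀ t ∈ Ioc 0 T, |w.dx 1 t + l * w 1 t - g t| ≤ D₁)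
    (hg : ∀ t ∈ Ioc 0 T, Real.exp (σ * t) * |g t| ≤ l * Y) :
    w.weightedNorm σ T ≤
      Real.exp (σ * T) * (2 / (lam - σ) * F + D₀ + 1 / l * D₁) + (I + J) + Y := by
  have hls : 0 < lam - σ := sub_pos.2 hσl
  have hexp : ∀ {t c : ℝ}, t ∈ Ioc 0 T → 0 ≤ c →
      Real.exp (σ * t) * c ≤ Real.exp (σ * T) * c := fun ht hc =>
    mul_le_mul_of_nonneg_right (Real.exp_le_exp.2 (mul_le_mul_of_nonneg_left ht.2 hσ.le)) hc
  have hweight : ∀ {t c C : ℝ}, t ∈ Ioc 0 T → |c| ≤ C →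
      Real.exp (σ * t) * |c| ≤ Real.exp (σ * T) * C := fun ht h =>
    (hexp ht (abs_nonneg _)).trans (mul_le_mul_of_nonneg_left h (Real.exp_pos _).le)
  set e := Real.exp (σ * T)
  have he : 0 ≤ e := (Real.exp_pos _).le
  -- G is the part of the constant K in the maximum principle that absorbs a source of size F on
  -- [0,T].
  set G := e * F / (lam - σ) with hG
  have hG0 : 0 ≤ G := div_nonneg (mul_nonneg he hF0) hls.le
  have hGe : (lam - σ) * G = e * F := by rw [hG]; field_simp
  have hpb := exp_mul_abs_le (σ := σ) (K := G + J) (T := T) hα.le (hσ.trans hσl).le hl.le hp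
    (fun x hx => (hJ x hx).trans (by linarith))
    (fun t ht x hx => (hweight ht (hF t ht x hx)).trans (by
      rw [← hGe]; exact mul_le_mul_of_nonneg_left (by linarith) hls.le))
    (.inr hp0) (fun t ht => by
      rw [hp1 t ht, abs_zero, mul_zero]
      positivity)
  -- The constant used for w is the sum of all contributions. The two copies of G account for the
  -- source of w and for that of p, which acts through the Dirichlet value.
  have hE : e * (2 / (lam - σ) * F + D₀ + 1 / l * D₁) = 2 * G + e * D₀ + e * D₁ / l := by
    rw [hG]; ring
  have h1 : 0 ≤ e * D₀ := mul_nonneg he hD₀0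
  have h2 : 0 ≤ e * D₁ / l := div_nonneg (mul_nonneg he hD₁0) hl.le
  rw [hE]
  refine weightedNorm_le (by positivity) ?_
  refine exp_mul_abs_le hα.le (hσ.trans hσl).le hl.le hw
    (fun x hx => (hI x hx).trans (by linarith))
    (fun t ht x hx => (hweight ht (hF t ht x hx)).trans (by
      rw [← hGe]; exact mul_le_mul_of_nonneg_left (by linarith) hls.le))
    (.inl fun t ht => ?_) (fun t ht => ?_)
  · have h3 := hpb t ⟨ht.1.le, ht.2⟩ 0 (left_mem_Icc.2 zero_le_one)
    have h4 := hweight ht (hw0 t ht)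
    have h5 : |w 0 t| ≤ |w 0 t - p 0 t| + |p 0 t| := by
      simpa using abs_add_le (w 0 t - p 0 t) (p 0 t)
    have h6 := mul_le_mul_of_nonneg_left h5 (Real.exp_pos (σ * t)).le
    linarith
  · have h4 := hweight ht (hw1 t ht)
    have h5 : |w.dx 1 t + l * w 1 t| ≤ |w.dx 1 t + l * w 1 t - g t| + |g t| := by
      simpa using abs_add_le (w.dx 1 t + l * w 1 t - g t) (g t)
    have h6 := mul_le_mul_of_nonneg_left h5 (Real.exp_pos (σ * t)).le
    have h7 : l * (e * D₁ / l) = e * D₁ := by field_simp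
    have h8 : 0 ≤ l * (2 * G + e * D₀ + (I + J)) := by positivity
    have h9 := hg t ht
    linarith

end Trajectory

/-! ### Size of the disturbances and of the initial errors -/

namespace Network

variable (S : Network)

theorem abs_f_le {i : ℕ} (hi : i ∈ Icc 1 S.N) {T t x : ℝ} (ht : t ∈ Ioc 0 T)
    (hx : x ∈ Icc (0 : ℝ) 1) : |S.f i x t| ≤ normCyl T (S.f i) :=
  abs_le_maxNorm (isCompact_Icc.prod isCompact_Icc) (x := (x, t))
    ((S.f_cont i hi).mono (prod_mono_right Icc_subset_Ici_self)) ⟨hx, ht.1.le, ht.2⟩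

theorem abs_f_sub_le {i j : ℕ} (hi : i ∈ Icc 1 S.N) (hj : j ∈ Icc 1 S.N) {T t x : ℝ}
    (ht : t ∈ Ioc 0 T) (hx : x ∈ Icc (0 : ℝ) 1) :
    |S.f i x t - S.f j x t| ≤ normCyl T (fun x s => S.f i x s - S.f j x s) :=
  abs_le_maxNorm (isCompact_Icc.prod isCompact_Icc) (x := (x, t))
    (h := fun p : ℝ × ℝ => S.f i p.1 p.2 - S.f j p.1 p.2)
    (((S.f_cont i hi).sub (S.f_cont j hj)).mono (prod_mono_right Icc_subset_Ici_self))
    ⟨hx, ht.1.le, ht.2⟩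

theorem abs_le_normTime {d : ℝ → ℝ} (hd : ContinuousOn d (Ici 0)) {T t : ℝ} (ht : t ∈ Ioc 0 T) :
    |d t| ≤ normTime T d :=
  abs_le_maxNorm isCompact_Icc (hd.mono Icc_subset_Ici_self) ⟨ht.1.le, ht.2⟩

theorem normCyl_nonneg (t : ℝ) (h : ℝ → ℝ → ℝ) : 0 ≤ normCyl t h := maxNorm_nonneg _ _

theorem normTime_nonneg (t : ℝ) (h : ℝ → ℝ) : 0 ≤ normTime t h := maxNorm_nonneg _ _

theorem normSpace_nonneg (h : ℝ → ℝ) : 0 ≤ normSpace h := maxNorm_nonneg _ _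

theorem Dcal_nonneg {σ : ℝ} (hσ : σ < S.lam) (t : ℝ) : 0 ≤ S.Dcal σ t := by
  have h1 : 0 ≤ 2 / (S.lam - σ) := div_nonneg zero_le_two (sub_pos.2 hσ).le
  have h2 : 0 ≤ 1 / S.l := div_nonneg zero_le_one S.l_pos.le
  exact add_nonneg (add_nonneg
    (mul_nonneg h1 (maxAgents_nonneg fun _ _ => normCyl_nonneg _ _))
    (maxAgents_nonneg fun _ _ => normTime_nonneg _ _))
    (mul_nonneg h2 (maxAgents_nonneg fun _ _ => normTime_nonneg _ _))

theorem Dtilde_nonneg {σ : ℝ} (hσ : σ < S.lam) (t : ℝ) : 0 ≤ S.Dtilde σ t := by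
  have h1 : 0 ≤ 2 / (S.lam - σ) := div_nonneg zero_le_two (sub_pos.2 hσ).le
  have h2 : 0 ≤ 1 / S.l := div_nonneg zero_le_one S.l_pos.le
  exact add_nonneg (add_nonneg
    (mul_nonneg h1 (maxPairs_nonneg fun _ _ => normCyl_nonneg _ _))
    (maxPairs_nonneg fun _ _ => normTime_nonneg _ _))
    (mul_nonneg h2 (maxPairs_nonneg fun _ _ => normTime_nonneg _ _))

theorem init_nonneg : 0 ≤ S.init :=
  add_nonneg (maxAgents_nonneg fun _ _ => normSpace_nonneg _)
    (maxAgents_nonneg fun _ _ => normSpace_nonneg _)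

theorem initPairs_nonneg : 0 ≤ S.initPairs :=
  add_nonneg (maxPairs_nonneg fun _ _ => normSpace_nonneg _)
    (maxPairs_nonneg fun _ _ => normSpace_nonneg _)

theorem Htilde_nonneg {i j : ℕ} (hj : j ∈ Icc 1 S.N) : 0 ≤ S.Htilde i j := by
  have hH : 0 ≤ S.Hcal (cyc S.N ((i : ℤ) - 1)) (cyc S.N ((j : ℤ) - 1)) :=
    (Finset.sum_nonneg fun m _ => div_nonneg
      (mul_nonneg (S.prod_kc_nonneg _ m) (abs_nonneg _)) (pow_pos S.l_pos _).le).trans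
      (S.sum_prod_le_Hcal (cyc_mem S.N_pos _) (cyc_mem S.N_pos _))
  exact add_nonneg (div_nonneg (mul_nonneg (S.k_mem j hj).1.le hH)
    (mul_pos S.l_pos (sub_pos.2 S.loopGain_lt_one)).le)
    (div_nonneg (abs_nonneg _) S.l_pos.le)

theorem Dcal_le {σ t B : ℝ} (hσ : σ < S.lam) (hB0 : 0 ≤ B)
    (hB : ∀ m ∈ Icc 1 S.N, ∀ s : ℝ, 0 ≤ s →
      (∀ x ∈ Icc (0 : ℝ) 1, |S.f m x s| ≤ B) ∧ |S.d₀ m s| ≤ B ∧ |S.d₁ m s| ≤ B) :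
    S.Dcal σ t ≤ 2 / (S.lam - σ) * B + B + 1 / S.l * B := by
  have h1 : 0 ≤ 2 / (S.lam - σ) := div_nonneg zero_le_two (sub_pos.2 hσ).le
  have h2 : 0 ≤ 1 / S.l := div_nonneg zero_le_one S.l_pos.le
  refine add_le_add (add_le_add (mul_le_mul_of_nonneg_left ?_ h1) ?_)
    (mul_le_mul_of_nonneg_left ?_ h2)
  · exact maxAgents_le hB0 fun m hm => maxNorm_le hB0 fun p hp => (hB m hm _ hp.2.1).1 _ hp.1
  · exact maxAgents_le hB0 fun m hm => maxNorm_le hB0 fun s hs => (hB m hm _ hs.1).2.1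
  · exact maxAgents_le hB0 fun m hm => maxNorm_le hB0 fun s hs => (hB m hm _ hs.1).2.2

theorem Dtilde_le {σ t B : ℝ} (hσ : σ < S.lam) (hB0 : 0 ≤ B)
    (hB : ∀ m ∈ Icc 1 S.N, ∀ s : ℝ, 0 ≤ s →
      (∀ x ∈ Icc (0 : ℝ) 1, |S.f m x s| ≤ B) ∧ |S.d₀ m s| ≤ B ∧ |S.d₁ m s| ≤ B) :
    S.Dtilde σ t ≤ 2 / (S.lam - σ) * (2 * B) + 2 * B + 1 / S.l * (2 * B) := by
  have h1 : 0 ≤ 2 / (S.lam - σ) := div_nonneg zero_le_two (sub_pos.2 hσ).le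
  have h2 : 0 ≤ 1 / S.l := div_nonneg zero_le_one S.l_pos.le
  have hB2 : 0 ≤ 2 * B := by linarith
  have hsub : ∀ {a b : ℝ}, |a| ≤ B → |b| ≤ B → |a - b| ≤ 2 * B := fun ha hb =>
    (abs_sub _ _).trans (by linarith)
  refine add_le_add (add_le_add (mul_le_mul_of_nonneg_left ?_ h1) ?_)
    (mul_le_mul_of_nonneg_left ?_ h2)
  · exact maxPairs_le hB2 fun m hm n hn => maxNorm_le hB2 fun p hp =>
      hsub ((hB m hm _ hp.2.1).1 _ hp.1) ((hB n hn _ hp.2.1).1 _ hp.1)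
  · exact maxPairs_le hB2 fun m hm n hn => maxNorm_le hB2 fun s hs =>
      hsub (hB m hm _ hs.1).2.1 (hB n hn _ hs.1).2.1
  · exact maxPairs_le hB2 fun m hm n hn => maxNorm_le hB2 fun s hs =>
      hsub (hB m hm _ hs.1).2.2 (hB n hn _ hs.1).2.2

/-! ### The error system of the closed loop -/

namespace ClosedLoop

variable {S} (X : S.ClosedLoop)

/-- Tracking error of an agent. -/
def trackErr (i : ℕ) : Trajectory := (X.u i).sub X.uref

/-- Observer error of an agent. -/
def obsErr (i : ℕ) : Trajectory := ((X.u i).sub (X.v i)).sub (X.qhat i)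

theorem trackErr_solves {i : ℕ} (hi : i ∈ Icc 1 S.N) :
    SolvesHeat S.α S.lam (S.f i) (X.trackErr i) := by
  simpa [trackErr] using (X.u_pde i hi).sub X.uref_pde

theorem obsErr_solves {i : ℕ} (hi : i ∈ Icc 1 S.N) :
    SolvesHeat S.α S.lam (S.f i) (X.obsErr i) := by
  simpa [obsErr] using ((X.u_pde i hi).sub (X.v_pde i hi)).sub (X.qhat_pde i hi)

theorem trackErr_init {i : ℕ} (hi : i ∈ Icc 1 S.N) {x : ℝ} (hx : x ∈ Icc (0 : ℝ) 1) :
    X.trackErr i x 0 = S.trackErr₀ i x := by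
  simp [trackErr, trackErr₀, X.u_init i hi x hx, X.uref_init x hx]

theorem obsErr_init {i : ℕ} (hi : i ∈ Icc 1 S.N) {x : ℝ} (hx : x ∈ Icc (0 : ℝ) 1) :
    X.obsErr i x 0 = S.obsErr₀ i x := by
  simp [obsErr, obsErr₀, X.u_init i hi x hx, X.v_init i hi x hx, X.qhat_init i hi x hx]

theorem obsErr_left {i : ℕ} (hi : i ∈ Icc 1 S.N) {t : ℝ} (ht : 0 < t) :
    (X.obsErr i).dx 0 t = 0 := by
  simp [obsErr, X.qhat_left i hi t ht]

theorem obsErr_right {i : ℕ} (hi : i ∈ Icc 1 S.N) {t : ℝ} (ht : 0 < t) :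
    (X.obsErr i).dx 1 t + S.l * X.obsErr i 1 t = 0 := by
  simp only [obsErr, Trajectory.sub_dx, Trajectory.sub_val, X.u_right i hi t ht,
    X.v_right i hi t ht, X.qhat_right i hi t ht]
  ring

/-- At x = 0 the observer error is q - q̂(0,t), and the control law leaves exactly this plus d₀ in
the tracking error. -/
theorem trackErr_left {i : ℕ} (hi : i ∈ Icc 1 S.N) {t : ℝ} (ht : 0 < t) :
    X.trackErr i 0 t - X.obsErr i 0 t = S.d₀ i t := by
  simp only [trackErr, obsErr, Trajectory.sub_val, X.u_left i hi t ht, X.v_left i hi t ht,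
    X.uref_left t ht, X.control₀ i hi t ht]
  ring

theorem trackErr_right {i : ℕ} (hi : i ∈ Icc 1 S.N) {t : ℝ} (ht : 0 < t) :
    (X.trackErr i).dx 1 t + S.l * X.trackErr i 1 t -
      S.k i * X.trackErr (cyc S.N ((i : ℤ) - 1)) 1 t = S.d₁ i t := by
  simp only [trackErr, Trajectory.sub_dx, Trajectory.sub_val, X.u_right i hi t ht,
    X.uref_right t ht, X.control₁ i hi t ht]
  ring

/-- The prescribed initial data carry no continuity assumption of their own; it comes from the
trajectory at time 0. -/
theorem abs_trackErr_init_le {i : ℕ} (hi : i ∈ Icc 1 S.N) {x : ℝ} (hx : x ∈ Icc (0 : ℝ) 1) :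
    |X.trackErr i x 0| ≤ normSpace (S.trackErr₀ i) := by
  rw [X.trackErr_init hi hx]
  refine abs_le_maxNorm isCompact_Icc ?_ hx
  exact ((X.trackErr i).continuousOn_val 0 le_rfl).congr fun y hy => (X.trackErr_init hi hy).symm

theorem abs_obsErr_init_le {i : ℕ} (hi : i ∈ Icc 1 S.N) {x : ℝ} (hx : x ∈ Icc (0 : ℝ) 1) :
    |X.obsErr i x 0| ≤ normSpace (S.obsErr₀ i) := by
  rw [X.obsErr_init hi hx]
  refine abs_le_maxNorm isCompact_Icc ?_ hx
  exact ((X.obsErr i).continuousOn_val 0 le_rfl).congr fun y hy => (X.obsErr_init hi hy).symm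

theorem abs_trackErr_sub_init_le {i j : ℕ} (hi : i ∈ Icc 1 S.N) (hj : j ∈ Icc 1 S.N) {x : ℝ}
    (hx : x ∈ Icc (0 : ℝ) 1) : |(X.trackErr i).sub (X.trackErr j) x 0| ≤
      normSpace (fun x => S.trackErr₀ i x - S.trackErr₀ j x) := by
  rw [Trajectory.sub_val, X.trackErr_init hi hx, X.trackErr_init hj hx]
  refine abs_le_maxNorm (h := fun x => S.trackErr₀ i x - S.trackErr₀ j x) isCompact_Icc ?_ hx
  refine (((X.trackErr i).sub (X.trackErr j)).continuousOn_val 0 le_rfl).congr fun y hy => ?_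
  simp only [Trajectory.sub_val, X.trackErr_init hi hy, X.trackErr_init hj hy]

theorem abs_obsErr_sub_init_le {i j : ℕ} (hi : i ∈ Icc 1 S.N) (hj : j ∈ Icc 1 S.N) {x : ℝ}
    (hx : x ∈ Icc (0 : ℝ) 1) : |(X.obsErr i).sub (X.obsErr j) x 0| ≤
      normSpace (fun x => S.obsErr₀ i x - S.obsErr₀ j x) := by
  rw [Trajectory.sub_val, X.obsErr_init hi hx, X.obsErr_init hj hx]
  refine abs_le_maxNorm (h := fun x => S.obsErr₀ i x - S.obsErr₀ j x) isCompact_Icc ?_ hx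
  refine (((X.obsErr i).sub (X.obsErr j)).continuousOn_val 0 le_rfl).congr fun y hy => ?_
  simp only [Trajectory.sub_val, X.obsErr_init hi hy, X.obsErr_init hj hy]

/-- The cascade bound is used with g = k_i w_{i-1}(1,t), whose contribution divided by l is the last
term. -/
theorem weightedNorm_trackErr_le_prev {σ T : ℝ} (hσ : σ ∈ Ioo 0 S.lam) {i : ℕ}
    (hi : i ∈ Icc 1 S.N) : (X.trackErr i).weightedNorm σ T ≤
      Real.exp (σ * T) * S.Dcal σ T + S.init +
        S.k i / S.l * (X.trackErr (cyc S.N ((i : ℤ) - 1))).weightedNorm σ T := by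
  have hk := (S.k_mem i hi).1
  have hl := S.l_pos
  refine Trajectory.weightedNorm_le_of_cascade S.α_pos hσ.1 hσ.2 S.l_pos
    (X.trackErr_solves hi) (X.obsErr_solves hi)
    (maxAgents_nonneg fun _ _ => normCyl_nonneg _ _)
    (maxAgents_nonneg fun _ _ => normTime_nonneg _ _)
    (maxAgents_nonneg fun _ _ => normTime_nonneg _ _)
    (maxAgents_nonneg fun _ _ => normSpace_nonneg _)
    (maxAgents_nonneg fun _ _ => normSpace_nonneg _)
    (mul_nonneg (div_pos hk hl).le (Trajectory.weightedNorm_nonneg _ _ _))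
    (fun t ht x hx => (S.abs_f_le hi ht (Ioo_subset_Icc_self hx)).trans
      (le_maxAgents hi fun i => normCyl T (S.f i)))
    (fun x hx => (X.abs_trackErr_init_le hi hx).trans
      (le_maxAgents hi fun i => normSpace (S.trackErr₀ i)))
    (fun x hx => (X.abs_obsErr_init_le hi hx).trans
      (le_maxAgents hi fun i => normSpace (S.obsErr₀ i)))
    (fun t ht => X.obsErr_left hi ht.1) (fun t ht => X.obsErr_right hi ht.1)
    (fun t ht => ?_)
    (g := fun t => S.k i * X.trackErr (cyc S.N ((i : ℤ) - 1)) 1 t)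
    (fun t ht => ?_) (fun t ht => ?_)
  · rw [X.trackErr_left hi ht.1]
    exact (abs_le_normTime (S.d₀_C1 i hi).continuousOn ht).trans
      (le_maxAgents hi fun i => normTime T (S.d₀ i))
  · rw [X.trackErr_right hi ht.1]
    exact (abs_le_normTime (S.d₁_C1 i hi).continuousOn ht).trans
      (le_maxAgents hi fun i => normTime T (S.d₁ i))
  · have h1 := (X.trackErr (cyc S.N ((i : ℤ) - 1))).exp_mul_abs_le_weightedNorm hσ.1.le
      (right_mem_Icc.2 zero_le_one) ⟨ht.1.le, ht.2⟩
    have h2 := mul_le_mul_of_nonneg_left h1 hk.le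
    rw [abs_mul, abs_of_pos hk]
    have h3 : S.l * (S.k i / S.l * (X.trackErr (cyc S.N ((i : ℤ) - 1))).weightedNorm σ T)
        = S.k i * (X.trackErr (cyc S.N ((i : ℤ) - 1))).weightedNorm σ T := by
      field_simp
    linarith

/-- The cascade bound for differences. The unequal gains leave (k_i - k_j) w_{i-1}(1,t), which P
controls. -/
theorem weightedNorm_trackErr_sub_le_prev {σ T P : ℝ} (hσ : σ ∈ Ioo 0 S.lam)
    (hP : ∀ i ∈ Icc 1 S.N, (X.trackErr i).weightedNorm σ T ≤ P) (hP0 : 0 ≤ P) {i j : ℕ}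
    (hi : i ∈ Icc 1 S.N) (hj : j ∈ Icc 1 S.N) :
    ((X.trackErr i).sub (X.trackErr j)).weightedNorm σ T ≤
      Real.exp (σ * T) * S.Dtilde σ T + S.initPairs + |S.k i - S.k j| / S.l * P +
        S.k j / S.l * ((X.trackErr (cyc S.N ((i : ℤ) - 1))).sub
          (X.trackErr (cyc S.N ((j : ℤ) - 1)))).weightedNorm σ T := by
  have hk := (S.k_mem j hj).1
  have hl := S.l_pos
  set i' := cyc S.N ((i : ℤ) - 1) with hi'
  set j' := cyc S.N ((j : ℤ) - 1) with hj'
  have hi'm : i' ∈ Icc 1 S.N := cyc_mem S.N_pos _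
  -- The last two summands together play the role of Y in the cascade bound.
  rw [add_assoc _ (|S.k i - S.k j| / S.l * P)]
  refine Trajectory.weightedNorm_le_of_cascade S.α_pos hσ.1 hσ.2 S.l_pos
    ((X.trackErr_solves hi).sub (X.trackErr_solves hj))
    ((X.obsErr_solves hi).sub (X.obsErr_solves hj))
    (maxPairs_nonneg fun _ _ => normCyl_nonneg _ _)
    (maxPairs_nonneg fun _ _ => normTime_nonneg _ _)
    (maxPairs_nonneg fun _ _ => normTime_nonneg _ _)
    (maxPairs_nonneg fun _ _ => normSpace_nonneg _)
    (maxPairs_nonneg fun _ _ => normSpace_nonneg _)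
    (add_nonneg (mul_nonneg (div_nonneg (abs_nonneg _) hl.le) hP0)
      (mul_nonneg (div_pos hk hl).le (Trajectory.weightedNorm_nonneg _ _ _)))
    (fun t ht x hx => (S.abs_f_sub_le hi hj ht (Ioo_subset_Icc_self hx)).trans
      (le_maxPairs hi hj fun i j => normCyl T (fun x s => S.f i x s - S.f j x s)))
    (fun x hx => (X.abs_trackErr_sub_init_le hi hj hx).trans
      (le_maxPairs hi hj fun i j => normSpace (fun x => S.trackErr₀ i x - S.trackErr₀ j x)))
    (fun x hx => (X.abs_obsErr_sub_init_le hi hj hx).trans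
      (le_maxPairs hi hj fun i j => normSpace (fun x => S.obsErr₀ i x - S.obsErr₀ j x)))
    (fun t ht => ?_) (fun t ht => ?_) (fun t ht => ?_)
    (g := fun t => S.k i * X.trackErr i' 1 t - S.k j * X.trackErr j' 1 t)
    (fun t ht => ?_) (fun t ht => ?_)
  · rw [Trajectory.sub_dx, X.obsErr_left hi ht.1, X.obsErr_left hj ht.1, sub_zero]
  · rw [Trajectory.sub_dx, Trajectory.sub_val]
    linarith [X.obsErr_right hi ht.1, X.obsErr_right hj ht.1]
  · have h1 : (X.trackErr i).sub (X.trackErr j) 0 t - (X.obsErr i).sub (X.obsErr j) 0 t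
        = S.d₀ i t - S.d₀ j t := by
      rw [← X.trackErr_left hi ht.1, ← X.trackErr_left hj ht.1, Trajectory.sub_val,
        Trajectory.sub_val]
      ring
    rw [h1]
    exact (abs_le_normTime ((S.d₀_C1 i hi).continuousOn.sub (S.d₀_C1 j hj).continuousOn) ht).trans
      (le_maxPairs hi hj fun i j => normTime T (fun s => S.d₀ i s - S.d₀ j s))
  · have h1 : ((X.trackErr i).sub (X.trackErr j)).dx 1 t +
        S.l * (X.trackErr i).sub (X.trackErr j) 1 t -
        (S.k i * X.trackErr i' 1 t - S.k j * X.trackErr j' 1 t) = S.d₁ i t - S.d₁ j t := by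
      rw [← X.trackErr_right hi ht.1, ← X.trackErr_right hj ht.1, Trajectory.sub_val,
        Trajectory.sub_dx, ← hi', ← hj']
      ring
    rw [h1]
    exact (abs_le_normTime ((S.d₁_C1 i hi).continuousOn.sub (S.d₁_C1 j hj).continuousOn) ht).trans
      (le_maxPairs hi hj fun i j => normTime T (fun s => S.d₁ i s - S.d₁ j s))
  · have hT : t ∈ Icc 0 T := ⟨ht.1.le, ht.2⟩
    have h1 := ((X.trackErr i').exp_mul_abs_le_weightedNorm hσ.1.le
      (right_mem_Icc.2 zero_le_one) hT).trans (hP i' hi'm)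
    have h2 := ((X.trackErr i').sub (X.trackErr j')).exp_mul_abs_le_weightedNorm hσ.1.le
      (right_mem_Icc.2 zero_le_one) hT
    set Z := ((X.trackErr i').sub (X.trackErr j')).weightedNorm σ T
    rw [Trajectory.sub_val] at h2
    have h3 : |S.k i * X.trackErr i' 1 t - S.k j * X.trackErr j' 1 t| ≤
        |S.k i - S.k j| * |X.trackErr i' 1 t| +
          S.k j * |X.trackErr i' 1 t - X.trackErr j' 1 t| := by
      rw [← abs_of_pos hk, ← abs_mul, ← abs_mul, abs_of_pos hk]
      refine (le_of_eq ?_).trans (abs_add_le _ _)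
      congr 1
      ring
    have h4 := mul_le_mul_of_nonneg_left h3 (Real.exp_pos (σ * t)).le
    have h5 := mul_le_mul_of_nonneg_left h1 (abs_nonneg (S.k i - S.k j))
    have h6 := mul_le_mul_of_nonneg_left h2 hk.le
    have h7 : S.l * (|S.k i - S.k j| / S.l * P + S.k j / S.l * Z)
        = |S.k i - S.k j| * P + S.k j * Z := by
      field_simp
    linarith

/-- The cyclic system for single agents supplies P, which feeds the cyclic system for pairs;
evaluating at the final time T and dividing by e^{σT} removes the weight from 𝒟 and puts the decay
on the initial errors. -/
theorem normSpace_syncErr_le {σ T : ℝ} (hσ : σ ∈ Ioo 0 S.lam) (hT : 0 < T) {i j : ℕ}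
    (hi : i ∈ Icc 1 S.N) (hj : j ∈ Icc 1 S.N) :
    normSpace (X.syncErr i j T) ≤ S.Ctilde j * S.Dtilde σ T
      + S.Ctilde j * Real.exp (-σ * T) * S.initPairs
      + S.Htilde i j * maxAgents S.N S.Ctilde *
          (S.Dcal σ T + Real.exp (-σ * T) * S.init) := by
  set e := Real.exp (σ * T)
  have he : 0 < e := Real.exp_pos _
  have hee : Real.exp (-σ * T) * e = 1 := by
    rw [← Real.exp_add]
    simp
  set e' := Real.exp (-σ * T)
  have he' : 0 < e' := Real.exp_pos _
  have hE : 0 ≤ e * S.Dcal σ T + S.init :=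
    add_nonneg (mul_nonneg he.le (S.Dcal_nonneg hσ.2 T)) S.init_nonneg
  have hE' : 0 ≤ e * S.Dtilde σ T + S.initPairs :=
    add_nonneg (mul_nonneg he.le (S.Dtilde_nonneg hσ.2 T)) S.initPairs_nonneg
  set P := maxAgents S.N S.Ctilde * (e * S.Dcal σ T + S.init)
  have hP0 : 0 ≤ P := mul_nonneg (maxAgents_nonneg fun i hi => S.Ctilde_nonneg hi) hE
  have hP : ∀ m ∈ Icc 1 S.N, (X.trackErr m).weightedNorm σ T ≤ P := fun m hm =>
    (S.le_Ctilde_of_cyclic (y := fun m => (X.trackErr m).weightedNorm σ T) hE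
      (fun i hi => X.weightedNorm_trackErr_le_prev hσ hi) hm).trans
      (mul_le_mul_of_nonneg_right (le_maxAgents hm S.Ctilde) hE)
  have hZ := S.le_Htilde_of_cyclic_pairs
    (z := fun i j => ((X.trackErr i).sub (X.trackErr j)).weightedNorm σ T) hE' hP0
    (fun i hi j hj => X.weightedNorm_trackErr_sub_le_prev hσ hP hP0 hi hj) hi hj
  have hR : S.Ctilde j * S.Dtilde σ T + S.Ctilde j * e' * S.initPairs
      + S.Htilde i j * maxAgents S.N S.Ctilde * (S.Dcal σ T + e' * S.init)
      = e' * (S.Ctilde j * (e * S.Dtilde σ T + S.initPairs) + S.Htilde i j * P) := by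
    linear_combination (-(S.Ctilde j * S.Dtilde σ T) -
      S.Htilde i j * maxAgents S.N S.Ctilde * S.Dcal σ T) * hee
  rw [hR]
  have h0 : 0 ≤ S.Ctilde j * (e * S.Dtilde σ T + S.initPairs) + S.Htilde i j * P :=
    add_nonneg (mul_nonneg (S.Ctilde_nonneg hj) hE') (mul_nonneg (S.Htilde_nonneg hj) hP0)
  refine maxNorm_le (mul_nonneg he'.le h0) fun x hx => ?_
  have h1 := (((X.trackErr i).sub (X.trackErr j)).exp_mul_abs_le_weightedNorm hσ.1.le hx
    (right_mem_Icc.2 hT.le)).trans hZ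
  have h2 : (X.trackErr i).sub (X.trackErr j) x T = X.syncErr i j T x := by
    simp [trackErr, syncErr]
  rw [h2] at h1
  have h3 := mul_le_mul_of_nonneg_left h1 he'.le
  rwa [← mul_assoc, hee, one_mul] at h3

end ClosedLoop

end Network

end SyncPDE

end

/-! ### The three assertions -/

theorem theorem3 (S : SyncPDE.Network) (X : S.ClosedLoop) (σ : ℝ) (hσ : σ ∈ Set.Ioo 0 S.lam)
    (i j : ℕ) (hi : i ∈ Set.Icc 1 S.N) (hj : j ∈ Set.Icc 1 S.N) :
    -- the estimate
    (∀ t : ℝ, 0 < t →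
      SyncPDE.normSpace (X.syncErr i j t) ≤
        S.Ctilde j * S.Dtilde σ t
        + S.Ctilde j * Real.exp (-σ * t) * S.initPairs
        + S.Htilde i j * SyncPDE.maxAgents S.N S.Ctilde *
            (S.Dcal σ t + Real.exp (-σ * t) * S.init)) ∧
    -- exponential synchronization without unobservable disturbances
    ((∀ m ∈ Set.Icc 1 S.N, ∀ t : ℝ, 0 ≤ t →
        (∀ x ∈ Set.Icc (0 : ℝ) 1, S.f m x t = 0) ∧ S.d₀ m t = 0 ∧ S.d₁ m t = 0) →
      ∀ t : ℝ, 0 < t →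
        SyncPDE.normSpace (X.syncErr i j t) ≤
          (S.Ctilde j * S.initPairs
            + S.Htilde i j * SyncPDE.maxAgents S.N S.Ctilde * S.init) * Real.exp (-σ * t)) ∧
    -- boundedness under bounded unobservable disturbances
    ((∃ B : ℝ, ∀ m ∈ Set.Icc 1 S.N, ∀ t : ℝ, 0 ≤ t →
        (∀ x ∈ Set.Icc (0 : ℝ) 1, |S.f m x t| ≤ B) ∧ |S.d₀ m t| ≤ B ∧ |S.d₁ m t| ≤ B) →
      ∃ C : ℝ, ∀ t : ℝ, 0 < t → SyncPDE.normSpace (X.syncErr i j t) ≤ C) := by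
  have hC := S.Ctilde_nonneg hj
  have hH := mul_nonneg (S.Htilde_nonneg (i := i) hj)
    (SyncPDE.maxAgents_nonneg fun m hm => S.Ctilde_nonneg hm)
  refine ⟨fun t ht => X.normSpace_syncErr_le hσ ht hi hj, fun h t ht => ?_, ?_⟩
  -- Vanishing disturbances are the case B = 0 of the bounds on 𝒟 and 𝒟̃.
  · have hB : ∀ m ∈ Set.Icc 1 S.N, ∀ s : ℝ, 0 ≤ s →
        (∀ x ∈ Set.Icc (0 : ℝ) 1, |S.f m x s| ≤ 0) ∧ |S.d₀ m s| ≤ 0 ∧ |S.d₁ m s| ≤ 0 := by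
      simpa only [abs_nonpos_iff] using h
    have h1 := S.Dcal_le (t := t) hσ.2 le_rfl hB
    have h2 := S.Dtilde_le (t := t) hσ.2 le_rfl hB
    simp only [mul_zero, add_zero] at h1 h2
    refine (X.normSpace_syncErr_le hσ ht hi hj).trans ?_
    have h3 := mul_nonpos_of_nonneg_of_nonpos hC h2
    have h4 := mul_nonpos_of_nonneg_of_nonpos hH h1
    linarith
  · rintro ⟨B, hB⟩
    have hB' : ∀ m ∈ Set.Icc 1 S.N, ∀ s : ℝ, 0 ≤ s → (∀ x ∈ Set.Icc (0 : ℝ) 1,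
        |S.f m x s| ≤ max B 0) ∧ |S.d₀ m s| ≤ max B 0 ∧ |S.d₁ m s| ≤ max B 0 :=
      fun m hm s hs => ⟨fun x hx => ((hB m hm s hs).1 x hx).trans (le_max_left _ _),
        (hB m hm s hs).2.1.trans (le_max_left _ _), (hB m hm s hs).2.2.trans (le_max_left _ _)⟩
    -- The bound is uniform in t because e^{-σt} ≤ 1 and the bounds on 𝒟 and 𝒟̃ do not involve t.
    refine ⟨_, fun t ht => (X.normSpace_syncErr_le hσ ht hi hj).trans (add_le_add (add_le_add
      (mul_le_mul_of_nonneg_left (S.Dtilde_le hσ.2 (le_max_right _ _) hB') hC)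
      (mul_le_mul_of_nonneg_right (mul_le_of_le_one_right hC ?_) S.initPairs_nonneg))
      (mul_le_mul_of_nonneg_left (add_le_add (S.Dcal_le hσ.2 (le_max_right _ _) hB')
        (mul_le_of_le_one_left S.init_nonneg ?_)) hH))⟩ <;>
    · rw [Real.exp_le_one_iff, neg_mul, neg_nonpos]
      exact (mul_pos hσ.1 ht).le
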